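/- Let $\Bbbk$ be a field of characteristic $0$ and let $A=\sigma(\Bbbk[t])\langle x_1,x_2\rangle$ be a skew PBW extension: $A$ is a $\Bbbk$-algebra containing $\Bbbk[t]$, with elements $x_1,x_2\in A\setminus\Bbbk[t]$, such that the monomials $x_1^{\alpha_1}x_2^{\alpha_2}$ ($\alpha_1,\alpha_2\ge 0$) form a basis of $A$ as a left $\Bbbk[t]$-module; for each $i$ and each nonzero $r\in\Bbbk[t]$ there is a nonzero $c_{i,r}\in\Bbbk[t]$ with $x_ir-c_{i,r}x_i\in\Bbbk[t]$; and for all $i,j$ there is a nonzero $d_{i,j}\in\Bbbk[t]$ with $x_jx_i-d_{i,j}x_ix_j\in\Bbbk[t]+\Bbbk[t]x_1+\Bbbk[t]x_2$. Assume that the relations of $A$ are $$x_1t=(a_1t+b_1)x_1+p_1(t),\qquad x_2t=(a_2t+b_2)x_2+p_2(t),$$ $$x_2x_1=c\,x_1x_2+q_0+q_1x_1+q_2x_2,$$ where $a_i,b_i,c,q_0,q_1,q_2\in\Bbbk$, $a_1,a_2,c\neq 0$ and $p_1,p_2\in\Bbbk[t]$ (that is, $x_if=\sigma_i(f)x_i+\delta_i(f)$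 for $f\in\Bbbk[t]$, where $\sigma_i$ is the automorphism of $\Bbbk[t]$ with $\sigma_i(t)=a_it+b_i$ and $\delta_i$ is the $\sigma_i$-derivation with $\delta_i|_{\Bbbk}=0$, $\delta_i(t)=p_i$). Suppose that the parameters satisfy one of the following conditions. - (a) $a_1=a_2=1$, $b_1=b_2=0$, and either $p_1=p_2=0$ and $q_0=q_1=q_2=0$; or $q_1=q_2=0$ and $c=1$. - (b) $a_1=a_2=1$, $b_1=0$, $b_2\ne0$; (c) $a_1=a_2=1$, $b_1\neq0$, $b_2=0$; (d) $a_1=a_2=1$, $b_1\ne0$, $b_2\ne0$; and in each of these three cases either $p_1,p_2\in\Bbbk$, $c=1$ and $q_1=q_2=0$; or $p_1=p_2=0$ and $q_0=q_1=q_2=0$. - (e) $a_1=1$, $b_1=0$, $a_2\ne1$, $q_0=q_1=q_2=0$, and either $p_1=0$, $p_2=k\left(t+\frac{b_2}{a_2-1}\right)$ with $k\in\Bbbk$, $c=1$; or $p_1\in\Bbbk$, $p_2=0$, $c=a_2^{-1}$; or $p_1=p_2=0$, $c\notin\{1,a_2^{-1}\}$. - (g) $a_1\ne1$, $a_2=1$,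 $b_2=0$, $q_0=q_1=q_2=0$, and either $p_1=k\left(t+\frac{b_1}{a_1-1}\right)$ with $k\in\Bbbk$, $p_2=0$, $c=1$; or $p_1=0$, $p_2\in\Bbbk$, $c\in\{a_1,a_1^{-1}\}$; or $p_1=p_2=0$, $c\notin\{1,a_1^{-1}\}$. - (i) $a_1\ne1$, $a_2\neq1$, $b_1=b_2=0$, $p_1=k_1t$, $p_2=k_2t$ with $k_1,k_2\in\Bbbk$, $c=1$ and $q_0=q_1=q_2=0$. Then $A$ is differentially smooth, that is: $A$ is a finitely generated $\Bbbk$-algebra, its Gelfand–Kirillov dimension is an integer $n$, and $A$ admits an $n$-dimensional connected integrable differential calculus $(\Omega A,d)$. Here a differential calculus over $A$ is a differential graded algebra $(\Omega A=\bigoplus_{k\ge0}\Omega^kA,d)$ with $\Omega^0A=A$ and $\Omega^kA=A\,dA\wedge\dots\wedge dA$ ($k$ factors $dA$) for all $k$. It has dimension $n$ if $\Omega^nA\ne0$ and $\Omega^mA=0$ for $m>n$, and it is connected if $\ker(d|_A)=\Bbbk$. Let $\mathcal I_kA=\mathrm{Hom}_A(\Omega^kA,A)$ be the space of right $A$-linear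 maps, with $(a\cdot\phi\cdot b)(\omega)=a\phi(b\omega)$ and $(\phi\cdot\omega)(\omega')=\phi(\omega\wedge\omega')$. A divergence is a linear map $\nabla:\mathcal I_1A\to A$ with $\nabla(\phi\cdot a)=\nabla(\phi)a+\phi(da)$, extended to $\nabla_k:\mathcal I_{k+1}A\to\mathcal I_kA$ by $\nabla_k(\phi)(\omega)=\nabla(\phi\cdot\omega)+(-1)^{k+1}\phi(d\omega)$; it is flat if $\nabla\circ\nabla_1=0$. The $n$-dimensional calculus is integrable if there are a flat divergence $\nabla$, an algebra automorphism $\nu$ of $A$, and $A$-bimodule isomorphisms $\Theta_k:\Omega^kA\to{}^{\nu}\mathcal I_{n-k}A$ for $0\le k\le n$ (left action on the target twisted by $\nu$) such that $\Theta_{k+1}\circ d=\nabla_{n-k-1}\circ\Theta_k$ for $0\le k<n$. -/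

import Mathlib

open Polynomial

universe u v

noncomputable section

/-! ## Skew PBW extensions -/

/-- The ordered monomial `x₁^α₁ ⋯ xₙ^αₙ`. -/
def orderedMonomial {A : Type v} [Ring A] {n : ℕ} (x : Fin n → A) (α : Fin n → ℕ) : A :=
  (List.ofFn fun i => x i ^ α i).prod

/-- `A` is a skew PBW extension of `R` (embedded by `ι`) in the indeterminates `x₁, …, xₙ`. -/
structure IsSkewPBW {R : Type u} {A : Type v} [Ring R] [Ring A] {n : ℕ}
    (ι : R →+* A) (x : Fin n → A) : Prop where
  injective : Function.Injective ι
  notMem : ∀ i, x i ∉ ι.range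
  /-- the ordered monomials form a basis of `A` as a left `R`-module -/
  basis : Function.Bijective
    (fun f : (Fin n → ℕ) →₀ R => f.sum fun α r => ι r * orderedMonomial x α)
  mul_coeff : ∀ (i : Fin n) (r : R), r ≠ 0 → ∃ c : R, c ≠ 0 ∧ x i * ι r - ι c * x i ∈ ι.range
  mul_var : ∀ i j : Fin n, ∃ e : R, e ≠ 0 ∧ ∃ (r₀ : R) (r : Fin n → R),
    x j * x i - ι e * x i * x j = ι r₀ + ∑ k, ι (r k) * x k

/-- The parameters of a bijective skew PBW extension of `𝕜[t]` in two indeterminates: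
`σᵢ(t) = aᵢ t + bᵢ`, `δᵢ(t) = pᵢ(t)` and
`x₂ x₁ = c x₁ x₂ + q₀ + q₁ x₁ + q₂ x₂` with constants `c, q₀, q₁, q₂`. -/
structure SkewPBWData (𝕜 : Type u) [Field 𝕜] where
  a₁ : 𝕜
  b₁ : 𝕜
  a₂ : 𝕜
  b₂ : 𝕜
  p₁ : 𝕜[X]
  p₂ : 𝕜[X]
  c : 𝕜
  q₀ : 𝕜
  q₁ : 𝕜
  q₂ : 𝕜
  /-- `σ₁` is an automorphism of `𝕜[t]` -/
  a₁_ne : a₁ ≠ 0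
  /-- `σ₂` is an automorphism of `𝕜[t]` -/
  a₂_ne : a₂ ≠ 0
  c_ne : c ≠ 0

/-- The `𝕜`-algebra `A` is a skew PBW extension `σ(𝕜[t])⟨x₁, x₂⟩` with the parameters `P`.
Since `𝕜` is central in `A`, the relations between `xᵢ` and `t` determine
`xᵢ f = σᵢ(f) xᵢ + δᵢ(f)` for all `f ∈ 𝕜[t]`. -/
structure SkewPBWData.IsExtension {𝕜 : Type u} [Field 𝕜] (P : SkewPBWData 𝕜)
    {A : Type v} [Ring A] [Algebra 𝕜 A] (ι : 𝕜[X] →ₐ[𝕜] A) (x₁ x₂ : A) : Prop where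
  isSkewPBW : IsSkewPBW (ι : 𝕜[X] →+* A) ![x₁, x₂]
  rel₁ : x₁ * ι X = ι (C P.a₁ * X + C P.b₁) * x₁ + ι P.p₁
  rel₂ : x₂ * ι X = ι (C P.a₂ * X + C P.b₂) * x₂ + ι P.p₂
  rel₁₂ : x₂ * x₁ = P.c • (x₁ * x₂) + algebraMap 𝕜 A P.q₀ + P.q₁ • x₁ + P.q₂ • x₂

namespace SkewPBWData

variable {𝕜 : Type u} [Field 𝕜] (P : SkewPBWData 𝕜)

/-- `q₀ = q₁ = q₂ = 0` -/
def QZero : Prop := P.q₀ = 0 ∧ P.q₁ = 0 ∧ P.q₂ = 0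

/-- The two alternatives shared by the cases (b), (c), (d). -/
def ShiftRows : Prop :=
  ((∃ k₁ : 𝕜, P.p₁ = C k₁) ∧ (∃ k₂ : 𝕜, P.p₂ = C k₂) ∧ P.c = 1 ∧ P.q₁ = 0 ∧ P.q₂ = 0) ∨
  (P.p₁ = 0 ∧ P.p₂ = 0 ∧ P.QZero)

def CaseA : Prop :=
  (P.a₁ = 1 ∧ P.b₁ = 0 ∧ P.a₂ = 1 ∧ P.b₂ = 0) ∧
  ((P.p₁ = 0 ∧ P.p₂ = 0 ∧ P.QZero) ∨ (P.q₁ = 0 ∧ P.q₂ = 0 ∧ P.c = 1))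

def CaseB : Prop := (P.a₁ = 1 ∧ P.b₁ = 0 ∧ P.a₂ = 1 ∧ P.b₂ ≠ 0) ∧ P.ShiftRows

def CaseC : Prop := (P.a₁ = 1 ∧ P.b₁ ≠ 0 ∧ P.a₂ = 1 ∧ P.b₂ = 0) ∧ P.ShiftRows

def CaseD : Prop := (P.a₁ = 1 ∧ P.b₁ ≠ 0 ∧ P.a₂ = 1 ∧ P.b₂ ≠ 0) ∧ P.ShiftRows

def CaseE : Prop :=
  (P.a₁ = 1 ∧ P.b₁ = 0 ∧ P.a₂ ≠ 1) ∧ P.QZero ∧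
  ((P.p₁ = 0 ∧ (∃ k : 𝕜, P.p₂ = C k * (X + C (P.b₂ / (P.a₂ - 1)))) ∧ P.c = 1) ∨
   ((∃ k : 𝕜, P.p₁ = C k) ∧ P.p₂ = 0 ∧ P.c = P.a₂⁻¹) ∨
   (P.p₁ = 0 ∧ P.p₂ = 0 ∧ P.c ≠ 1 ∧ P.c ≠ P.a₂⁻¹))

def CaseG : Prop :=
  (P.a₁ ≠ 1 ∧ P.a₂ = 1 ∧ P.b₂ = 0) ∧ P.QZero ∧
  (((∃ k : 𝕜, P.p₁ = C k * (X + C (P.b₁ / (P.a₁ - 1)))) ∧ P.p₂ = 0 ∧ P.c = 1) ∨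
   (P.p₁ = 0 ∧ (∃ k : 𝕜, P.p₂ = C k) ∧ (P.c = P.a₁ ∨ P.c = P.a₁⁻¹)) ∨
   (P.p₁ = 0 ∧ P.p₂ = 0 ∧ P.c ≠ 1 ∧ P.c ≠ P.a₁⁻¹))

def CaseI : Prop :=
  (P.a₁ ≠ 1 ∧ P.a₂ ≠ 1 ∧ P.b₁ = 0 ∧ P.b₂ = 0) ∧
  (∃ k₁ : 𝕜, P.p₁ = C k₁ * X) ∧ (∃ k₂ : 𝕜, P.p₂ = C k₂ * X) ∧ P.c = 1 ∧ P.QZero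

end SkewPBWData

/-! ## Gelfand–Kirillov dimension -/

/-- The Gelfand–Kirillov dimension of a `𝕜`-algebra: the supremum over the finite-dimensional
subspaces `V` containing `1` of `limsup log (dim Vⁿ) / log n`. If `A` is affine, each `V` that
generates `A` attains the supremum. -/
def gkDim (𝕜 : Type u) (A : Type v) [Field 𝕜] [Ring A] [Algebra 𝕜 A] : EReal :=
  ⨆ (V : Submodule 𝕜 A) (_ : V.FG) (_ : (1 : A) ∈ V),
    Filter.limsup
      (fun n : ℕ => ((Real.log (Module.finrank 𝕜 (V ^ n : Submodule 𝕜 A)) / Real.log n : ℝ) : EReal))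
      Filter.atTop

/-! ## Differential calculi -/

/-- A differential calculus `(ΩA, d)` over the `𝕜`-algebra `A`: a differential graded algebra with
`Ω⁰A = A` (through `ι`) and `ΩⁿA = A dA ∧ ⋯ ∧ dA` for all `n`. The product `∧` is the ring
multiplication of `Ω`. -/
structure DiffCalculus (𝕜 : Type u) (A : Type v) [Field 𝕜] [Ring A] [Algebra 𝕜 A] where
  Ω : Type v
  [ring : Ring Ω]
  [algebra : Algebra 𝕜 Ω]
  /-- the space `ΩⁿA` of `n`-forms -/
  form : ℕ → Submodule 𝕜 Ω
  [graded : GradedAlgebra form]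
  d : Ω →ₗ[𝕜] Ω
  d_mem : ∀ (k : ℕ) (ω : Ω), ω ∈ form k → d ω ∈ form (k + 1)
  leibniz : ∀ (k : ℕ) (ω η : Ω), ω ∈ form k → d (ω * η) = d ω * η + (-1) ^ k * (ω * d η)
  d_d : ∀ ω : Ω, d (d ω) = 0
  ι : A →ₐ[𝕜] Ω
  ι_injective : Function.Injective ι
  range_ι : Subalgebra.toSubmodule ι.range = form 0
  density : ∀ n : ℕ, form n = form 0 * (form 0).map d ^ n

attribute [instance] DiffCalculus.ring DiffCalculus.algebra DiffCalculus.graded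

namespace DiffCalculus

variable {𝕜 : Type u} {A : Type v} [Field 𝕜] [Ring A] [Algebra 𝕜 A] (K : DiffCalculus 𝕜 A)

theorem ι_mem (a : A) : K.ι a ∈ K.form 0 := by
  rw [← K.range_ι]; exact ⟨a, rfl⟩

/-- The differential `ΩᵏA → Ωᵏ⁺¹A`. -/
def diff {k : ℕ} (ω : K.form k) : K.form (k + 1) := ⟨K.d ω, K.d_mem k ω ω.2⟩

/-- The differential `A → Ω¹A`. -/
def diffZero (a : A) : K.form 1 := ⟨K.d (K.ι a), K.d_mem 0 _ (K.ι_mem a)⟩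

/-- The product `ΩᵏA × ΩᵐA → Ωᵏ⁺ᵐA`. -/
def wedge {k m : ℕ} (ω : K.form k) (η : K.form m) : K.form (k + m) :=
  ⟨ω * η, SetLike.mul_mem_graded ω.2 η.2⟩

/-- The bimodule action `a ω b` of `A` on `ΩᵏA`. -/
def act {k : ℕ} (a : A) (ω : K.form k) (b : A) : K.form k :=
  ⟨K.ι a * ω * K.ι b, by
    have h := SetLike.mul_mem_graded (SetLike.mul_mem_graded (K.ι_mem a) ω.2) (K.ι_mem b)
    rwa [zero_add, add_zero] at h⟩

/-- `ker (d : A → Ω¹A) = 𝕜`. -/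
def IsConnected : Prop := ∀ a : A, K.d (K.ι a) = 0 ↔ a ∈ Set.range (algebraMap 𝕜 A)

def HasDimension (n : ℕ) : Prop := K.form n ≠ ⊥ ∧ ∀ m, n < m → K.form m = ⊥

/-- `𝓘ₖA`, the right dual of `ΩᵏA`: all right `A`-linear maps `ΩᵏA → A`. -/
def integralForm (k : ℕ) : Submodule 𝕜 (K.form k →ₗ[𝕜] A) where
  carrier := {φ | ∀ (ω : K.form k) (b : A), φ (K.act 1 ω b) = φ ω * b}
  add_mem' := by
    intro φ ψ hφ hψ ω b
    simp only [LinearMap.add_apply, hφ ω b, hψ ω b, add_mul]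
  zero_mem' := by
    intro ω b
    simp
  smul_mem' := by
    intro c φ hφ ω b
    simp only [LinearMap.smul_apply, hφ ω b, smul_mul_assoc]

variable {K}

theorem integralForm_act {k : ℕ} (φ : K.integralForm k) (ω : K.form k) (b : A) :
    φ.1 (K.act 1 ω b) = φ.1 ω * b := φ.2 ω b

/-- The bimodule action on `𝓘ₖA`: `(a · φ · b)(ω) = a φ(b ω)`. -/
def dualAct {k : ℕ} (a : A) (φ : K.integralForm k) (b : A) : K.integralForm k :=
  ⟨{ toFun := fun ω => a * φ.1 (K.act b ω 1)
     map_add' := fun ω η => by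
      have h : K.act b (ω + η) 1 = K.act b ω 1 + K.act b η 1 := by
        ext; simp [act, mul_add]
      rw [h, map_add, mul_add]
     map_smul' := fun c ω => by
      have h : K.act b (c • ω) 1 = c • K.act b ω 1 := by
        ext; simp [act]
      rw [h, map_smul, RingHom.id_apply, mul_smul_comm] }, by
    intro ω e
    have h : K.act b (K.act 1 ω e) 1 = K.act 1 (K.act b ω 1) e := by
      ext; simp [act, mul_assoc]
    change a * φ.1 (K.act b (K.act 1 ω e) 1) = a * φ.1 (K.act b ω 1) * e
    rw [h, integralForm_act, mul_assoc]⟩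

/-- The right action of forms: `(φ · ω)(ω') = φ(ω ∧ ω')` for `φ ∈ 𝓘ₖ₊ₘA`, `ω ∈ ΩᵏA`. -/
def dualWedge {k m : ℕ} (φ : K.integralForm (k + m)) (ω : K.form k) : K.integralForm m :=
  ⟨{ toFun := fun η => φ.1 (K.wedge ω η)
     map_add' := fun η η' => by
      have h : K.wedge ω (η + η') = K.wedge ω η + K.wedge ω η' := by
        ext; simp [wedge, mul_add]
      rw [h, map_add]
     map_smul' := fun c η => by
      have h : K.wedge ω (c • η) = c • K.wedge ω η := by
        ext; simp [wedge]
      rw [h, map_smul, RingHom.id_apply] }, by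
    intro η e
    have h : K.wedge ω (K.act 1 η e) = K.act 1 (K.wedge ω η) e := by
      ext; simp [act, wedge, mul_assoc]
    change φ.1 (K.wedge ω (K.act 1 η e)) = φ.1 (K.wedge ω η) * e
    rw [h, integralForm_act]⟩

variable (K)

/-- A divergence (hom-connection) `∇ : 𝓘₁A → A`. -/
structure Divergence where
  toFun : K.integralForm 1 →ₗ[𝕜] A
  leibniz : ∀ (φ : K.integralForm 1) (a : A),
    toFun (dualAct 1 φ a) = toFun φ * a + φ.1 (K.diffZero a)

variable {K}

/-- The extension `∇ₖ : 𝓘ₖ₊₁A → 𝓘ₖA`,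
`∇ₖ(φ)(ω) = ∇(φ · ω) + (-1)^(k+1) φ(dω)`. -/
def Divergence.ext (D : K.Divergence) (k : ℕ) (φ : K.integralForm (k + 1)) : K.integralForm k :=
  ⟨{ toFun := fun ω => D.toFun (dualWedge φ ω) + (-1) ^ (k + 1) * φ.1 (K.diff ω)
     map_add' := fun ω η => by
      have h₁ : dualWedge φ (ω + η) = dualWedge φ ω + dualWedge φ η := by
        ext ρ
        change φ.1 (K.wedge (ω + η) ρ) = φ.1 (K.wedge ω ρ) + φ.1 (K.wedge η ρ)
        rw [← map_add]; congr 1; ext; simp [wedge, add_mul]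
      have h₂ : K.diff (ω + η) = K.diff ω + K.diff η := by
        ext; simp [diff]
      rw [h₁, h₂, map_add, map_add, mul_add]; abel
     map_smul' := fun c ω => by
      have h₁ : dualWedge φ (c • ω) = c • dualWedge φ ω := by
        ext ρ
        change φ.1 (K.wedge (c • ω) ρ) = c • φ.1 (K.wedge ω ρ)
        rw [← map_smul]; congr 1; ext; simp [wedge]
      have h₂ : K.diff (c • ω) = c • K.diff ω := by
        ext; simp [diff]
      rw [h₁, h₂, map_smul, map_smul, RingHom.id_apply, mul_smul_comm, smul_add] }, by
    intro ω b
    have h₁ : dualWedge φ (K.act 1 ω b) = dualAct 1 (dualWedge φ ω) b := by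
      ext ρ
      change φ.1 (K.wedge (K.act 1 ω b) ρ) = 1 * φ.1 (K.wedge ω (K.act b ρ 1))
      rw [one_mul]; congr 1; ext; simp [wedge, act, mul_assoc]
    have h₂ : K.diff (K.act 1 ω b) =
        K.act 1 (K.diff ω) b + ((-1 : 𝕜) ^ k) • K.wedge ω (K.diffZero b) := by
      ext
      simp only [diff, act, wedge, diffZero, map_one, one_mul, Submodule.coe_add,
        Submodule.coe_smul]
      rw [K.leibniz k _ _ ω.2]
      rcases Nat.even_or_odd k with e | e
      · simp [e.neg_one_pow]
      · simp [e.neg_one_pow]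
    change D.toFun (dualWedge φ (K.act 1 ω b)) + (-1) ^ (k + 1) * φ.1 (K.diff (K.act 1 ω b)) =
      (D.toFun (dualWedge φ ω) + (-1) ^ (k + 1) * φ.1 (K.diff ω)) * b
    have h₃ : (dualWedge φ ω).1 (K.diffZero b) = φ.1 (K.wedge ω (K.diffZero b)) := rfl
    rw [h₁, h₂, D.leibniz, map_add, map_smul, integralForm_act, h₃]
    rcases Nat.even_or_odd k with e | e
    · simp only [pow_succ, e.neg_one_pow, add_mul, mul_add, neg_mul, one_mul, one_smul, mul_neg]
      abel
    · simp only [pow_succ, e.neg_one_pow, add_mul, neg_mul, one_mul, neg_smul, one_smul, mul_neg,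
        neg_neg]
      abel⟩

/-- `∇ ∘ ∇₁ = 0`, so that `(𝓘A, ∇)` is a complex. -/
def Divergence.IsFlat (D : K.Divergence) : Prop :=
  ∀ φ : K.integralForm 2, D.toFun (D.ext 1 φ) = 0

variable (K)

/-- Integrability of an `n`-dimensional calculus: there are a complex of integral forms `(𝓘A, ∇)`, an
automorphism `ν` of `A` and `A`-bimodule isomorphisms `Θₖ : ΩᵏA → ^ν𝓘ₙ₋ₖA`, `0 ≤ k ≤ n`, with
`Θₖ₊₁ ∘ d = ∇ₙ₋ₖ₋₁ ∘ Θₖ`. Here `𝓘₀A = Hom_A(A, A)` is `A`, and `∇₀` becomes `∇`. -/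
def IsIntegrable (n : ℕ) : Prop :=
  ∃ D : K.Divergence, D.IsFlat ∧
  ∃ (ν : A ≃ₐ[𝕜] A) (Θ : ∀ k m : ℕ, k + m = n → (K.form k ≃ₗ[𝕜] K.integralForm m)),
    (∀ (k m : ℕ) (h : k + m = n) (a b : A) (ω : K.form k),
      Θ k m h (K.act a ω b) = dualAct (ν a) (Θ k m h ω) b) ∧
    (∀ (k m : ℕ) (h : k + (m + 1) = n) (h' : (k + 1) + m = n) (ω : K.form k),
      Θ (k + 1) m h' (K.diff ω) = D.ext m (Θ k (m + 1) h ω))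

end DiffCalculus

/-- An affine algebra of integer Gelfand–Kirillov dimension `n` is differentially smooth if it
admits an `n`-dimensional connected integrable differential calculus. -/
def IsDifferentiallySmooth (𝕜 : Type u) (A : Type v) [Field 𝕜] [Ring A] [Algebra 𝕜 A] : Prop :=
  Algebra.FiniteType 𝕜 A ∧
  ∃ n : ℕ, gkDim 𝕜 A = n ∧
    ∃ K : DiffCalculus 𝕜 A, K.HasDimension n ∧ K.IsConnected ∧ K.IsIntegrable n

end

/-!
The calculus is built from three "partial derivatives". On `A` there are commuting automorphisms
`ν₁, ν₂, ν₃` and skew derivations `D₁, D₂, D₃`, dual to `dt, dx₁, dx₂`, with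
`a dt = dt ν₁(a)`, `da = dt D₁(a) + dx₁ D₂(a) + dx₂ D₃(a)` and similarly for `dx₁, dx₂`. Differentiating
the three relations of `A` determines all of them on generators, and the conditions for them to exist are
identities between the parameters, collected in `SkewPBWData.Compatible`. All rows of the hypotheses satisfy
these identities; in two rows one of them comes from associativity in `A`
(`mul_derivative_comm`, `eq_zero_or_c_eq_a₁`). Existence rests on the universal property `exists_algHom` of
`A`, applied to `A` for the automorphisms and to `2 × 2` matrices over `A` for the derivations.

For `i < j` the operators with index `j` commute with those with index `i` up to one scalar. Therefore the
free right module on the eight products of `dt, dx₁, dx₂` is a differential graded algebra: a twisted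
exterior algebra (`SkewFrame.calculus`). The coefficient `π` of the volume form is linear up to the
automorphism `ν₁ν₂ν₃`, and `(ω, η) ↦ π(ω ∧ η)` is nondegenerate in complementary degrees. This alone gives
integrability (`DiffCalculus.isIntegrable_of_pairing`), the divergence being `π ∘ d`.

In characteristic zero the `Dᵢ` act on coordinates as partial derivatives up to injective maps, so that only
scalars are closed. The Gelfand–Kirillov dimension is `3`: giving `x₁, x₂` a large weight makes the span
of the monomials of bounded weight a multiplicative filtration of cubic growth.
-/

noncomputable section

/-! ### The calculus of a frame of skew derivations -/

/-- The data of a three-dimensional calculus with free basis `e₁, e₂, e₃` of one-forms: automorphisms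
`νᵢ` with `a eᵢ = eᵢ νᵢ(a)`, skew derivations `Dᵢ` with `da = ∑ eᵢ Dᵢ(a)`, and scalars with
`e₂ e₁ = -α e₁ e₂`, `e₃ e₁ = -β e₁ e₃`, `e₃ e₂ = -γ e₂ e₃`. All operators with different indices commute
up to these scalars. The elements `uᵢ` are coordinates, that is `duᵢ = eᵢ`. -/
structure SkewFrame (𝕜 : Type u) (A : Type v) [Field 𝕜] [Ring A] [Algebra 𝕜 A] where
  ν₁ : A ≃ₐ[𝕜] A
  ν₂ : A ≃ₐ[𝕜] A
  ν₃ : A ≃ₐ[𝕜] A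
  D₁ : A →ₗ[𝕜] A
  D₂ : A →ₗ[𝕜] A
  D₃ : A →ₗ[𝕜] A
  α : 𝕜
  β : 𝕜
  γ : 𝕜
  α_ne : α ≠ 0
  β_ne : β ≠ 0
  γ_ne : γ ≠ 0
  leibniz₁ : ∀ a b, D₁ (a * b) = D₁ a * b + ν₁ a * D₁ b
  leibniz₂ : ∀ a b, D₂ (a * b) = D₂ a * b + ν₂ a * D₂ b
  leibniz₃ : ∀ a b, D₃ (a * b) = D₃ a * b + ν₃ a * D₃ b
  ν₂ν₁ : ∀ a, ν₂ (ν₁ a) = ν₁ (ν₂ a)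
  ν₃ν₁ : ∀ a, ν₃ (ν₁ a) = ν₁ (ν₃ a)
  ν₃ν₂ : ∀ a, ν₃ (ν₂ a) = ν₂ (ν₃ a)
  D₂ν₁ : ∀ a, D₂ (ν₁ a) = α • ν₁ (D₂ a)
  D₃ν₁ : ∀ a, D₃ (ν₁ a) = β • ν₁ (D₃ a)
  D₃ν₂ : ∀ a, D₃ (ν₂ a) = γ • ν₂ (D₃ a)
  ν₂D₁ : ∀ a, ν₂ (D₁ a) = α • D₁ (ν₂ a)
  ν₃D₁ : ∀ a, ν₃ (D₁ a) = β • D₁ (ν₃ a)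
  ν₃D₂ : ∀ a, ν₃ (D₂ a) = γ • D₂ (ν₃ a)
  D₂D₁ : ∀ a, D₂ (D₁ a) = α • D₁ (D₂ a)
  D₃D₁ : ∀ a, D₃ (D₁ a) = β • D₁ (D₃ a)
  D₃D₂ : ∀ a, D₃ (D₂ a) = γ • D₂ (D₃ a)
  u₁ : A
  u₂ : A
  u₃ : A
  D₁u₁ : D₁ u₁ = 1
  D₂u₁ : D₂ u₁ = 0
  D₃u₁ : D₃ u₁ = 0
  D₁u₂ : D₁ u₂ = 0
  D₂u₂ : D₂ u₂ = 1
  D₃u₂ : D₃ u₂ = 0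
  D₁u₃ : D₁ u₃ = 0
  D₂u₃ : D₂ u₃ = 0
  D₃u₃ : D₃ u₃ = 1

namespace SkewFrame

variable {𝕜 : Type u} {A : Type v} [Field 𝕜] [Ring A] [Algebra 𝕜 A] (S : SkewFrame 𝕜 A)

/-- The space of forms `∑ e_s a_s`: the coordinates `0, …, 7` belong, in this order, to
`1, e₁, e₂, e₃, e₁e₂, e₁e₃, e₂e₃, e₁e₂e₃`, with coefficients on the right. -/
def Form (_ : SkewFrame 𝕜 A) : Type v := Fin 8 → A

instance : AddCommGroup S.Form := inferInstanceAs (AddCommGroup (Fin 8 → A))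
instance : Module 𝕜 S.Form := inferInstanceAs (Module 𝕜 (Fin 8 → A))

variable {S}

theorem forall_fin_eight {p : Fin 8 → Prop} (h₀ : p 0) (h₁ : p 1) (h₂ : p 2) (h₃ : p 3)
    (h₄ : p 4) (h₅ : p 5) (h₆ : p 6) (h₇ : p 7) : ∀ i, p i := by
  intro i
  fin_cases i <;> assumption

theorem Form.ext {x y : S.Form} (h : ∀ i : Fin 8, x i = y i) : x = y := funext h

@[simp] theorem add_coord (x y : S.Form) (i : Fin 8) : (x + y) i = x i + y i := rfl
@[simp] theorem zero_coord (i : Fin 8) : (0 : S.Form) i = 0 := rfl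
@[simp] theorem smul_coord (r : 𝕜) (x : S.Form) (i : Fin 8) : (r • x) i = r • x i := rfl

variable (S)

/-- The product of forms, in which left coefficients are moved to the right by `a eᵢ = eᵢ νᵢ(a)`. -/
def mulForm (x y : S.Form) : S.Form :=
  ![x 0 * y 0,
    S.ν₁ (x 0) * y 1 + x 1 * y 0,
    S.ν₂ (x 0) * y 2 + x 2 * y 0,
    S.ν₃ (x 0) * y 3 + x 3 * y 0,
    S.ν₁ (S.ν₂ (x 0)) * y 4 + x 4 * y 0 + S.ν₂ (x 1) * y 2 - S.α • (S.ν₁ (x 2) * y 1),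
    S.ν₁ (S.ν₃ (x 0)) * y 5 + x 5 * y 0 + S.ν₃ (x 1) * y 3 - S.β • (S.ν₁ (x 3) * y 1),
    S.ν₂ (S.ν₃ (x 0)) * y 6 + x 6 * y 0 + S.ν₃ (x 2) * y 3 - S.γ • (S.ν₂ (x 3) * y 2),
    S.ν₁ (S.ν₂ (S.ν₃ (x 0))) * y 7 + x 7 * y 0
      + S.ν₂ (S.ν₃ (x 1)) * y 6 - S.α • (S.ν₁ (S.ν₃ (x 2)) * y 5)
      + (S.β * S.γ) • (S.ν₁ (S.ν₂ (x 3)) * y 4)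
      + S.ν₃ (x 4) * y 3 - S.γ • (S.ν₂ (x 5) * y 2) + (S.α * S.β) • (S.ν₁ (x 6) * y 1)]

instance : Mul S.Form := ⟨S.mulForm⟩
instance : One S.Form := ⟨![1, 0, 0, 0, 0, 0, 0, 0]⟩

variable {S}

section coord
variable (x y : S.Form)
@[simp] theorem mul_zero_coord : (x * y) 0 = x 0 * y 0 := rfl
@[simp] theorem mul_one_coord : (x * y) 1 = S.ν₁ (x 0) * y 1 + x 1 * y 0 := rfl
@[simp] theorem mul_two_coord : (x * y) 2 = S.ν₂ (x 0) * y 2 + x 2 * y 0 := rfl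
@[simp] theorem mul_three_coord : (x * y) 3 = S.ν₃ (x 0) * y 3 + x 3 * y 0 := rfl
@[simp] theorem mul_four_coord : (x * y) 4 = S.ν₁ (S.ν₂ (x 0)) * y 4 + x 4 * y 0
    + S.ν₂ (x 1) * y 2 - S.α • (S.ν₁ (x 2) * y 1) := rfl
@[simp] theorem mul_five_coord : (x * y) 5 = S.ν₁ (S.ν₃ (x 0)) * y 5 + x 5 * y 0
    + S.ν₃ (x 1) * y 3 - S.β • (S.ν₁ (x 3) * y 1) := rfl
@[simp] theorem mul_six_coord : (x * y) 6 = S.ν₂ (S.ν₃ (x 0)) * y 6 + x 6 * y 0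
    + S.ν₃ (x 2) * y 3 - S.γ • (S.ν₂ (x 3) * y 2) := rfl
@[simp] theorem mul_seven_coord : (x * y) 7 = S.ν₁ (S.ν₂ (S.ν₃ (x 0))) * y 7 + x 7 * y 0
      + S.ν₂ (S.ν₃ (x 1)) * y 6 - S.α • (S.ν₁ (S.ν₃ (x 2)) * y 5)
      + (S.β * S.γ) • (S.ν₁ (S.ν₂ (x 3)) * y 4)
      + S.ν₃ (x 4) * y 3 - S.γ • (S.ν₂ (x 5) * y 2)
      + (S.α * S.β) • (S.ν₁ (x 6) * y 1) := rfl
@[simp] theorem one_zero_coord : (1 : S.Form) 0 = 1 := rfl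
theorem one_coord (i : Fin 8) (hi : i ≠ 0) : (1 : S.Form) i = 0 := by
  fin_cases i <;> first | exact absurd rfl hi | rfl
end coord

theorem mulForm_assoc (x y z : S.Form) : x * y * z = x * (y * z) := by
  refine Form.ext fun i => ?_
  fin_cases i <;>
  simp only [Fin.zero_eta, Fin.mk_one, Fin.reduceFinMk, mul_zero_coord, mul_one_coord,
    mul_two_coord, mul_three_coord, mul_four_coord, mul_five_coord, mul_six_coord,
    mul_seven_coord, map_add, map_sub, map_mul, map_smul, S.ν₂ν₁, S.ν₃ν₁, S.ν₃ν₂, add_mul, sub_mul,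
    mul_add, mul_sub, mul_assoc, smul_mul_assoc, mul_smul_comm] <;> module

instance : Ring S.Form :=
  { (inferInstance : AddCommGroup S.Form) with
    mul := (· * ·)
    one := 1
    mul_assoc := mulForm_assoc
    one_mul := fun x => Form.ext fun i => by fin_cases i <;> simp [one_coord]
    mul_one := fun x => Form.ext fun i => by fin_cases i <;> simp [one_coord]
    left_distrib := fun x y z => Form.ext fun i => by
      fin_cases i <;> simp [mul_add] <;> abel
    right_distrib := fun x y z => Form.ext fun i => by
      fin_cases i <;> simp [add_mul] <;> abel
    zero_mul := fun x => Form.ext fun i => by fin_cases i <;> simp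
    mul_zero := fun x => Form.ext fun i => by fin_cases i <;> simp }

instance : Algebra 𝕜 S.Form :=
  Algebra.ofModule
    (fun r x y => Form.ext fun i => by
      fin_cases i <;> simp [smul_sub, smul_add] <;> module)
    (fun r x y => Form.ext fun i => by
      fin_cases i <;> simp [smul_sub, smul_add] <;> module)

variable (S)

/-- The degree of the basis form `e_s`. -/
def deg : Fin 8 → ℕ := ![0, 1, 1, 1, 2, 2, 2, 3]

/-- The forms of degree `k`. -/
def homogeneous (k : ℕ) : Submodule 𝕜 S.Form where
  carrier := {x | ∀ i, deg i ≠ k → x i = 0}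
  add_mem' hx hy i hi := by rw [add_coord, hx i hi, hy i hi, add_zero]
  zero_mem' _ _ := rfl
  smul_mem' r x hx i hi := by rw [smul_coord, hx i hi, smul_zero]

variable {S}

theorem mem_homogeneous {k : ℕ} {x : S.Form} :
    x ∈ S.homogeneous k ↔ ∀ i, deg i ≠ k → x i = 0 := Iff.rfl

theorem coord_mul_eq_zero {i j : ℕ} {x y : S.Form} (hx : x ∈ S.homogeneous i)
    (hy : y ∈ S.homogeneous j) (f : A ≃ₐ[𝕜] A) (s t : Fin 8) (h : deg s + deg t ≠ i + j) :
    f (x s) * y t = 0 := by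
  by_cases hs : deg s = i
  · rw [hy t (by omega), mul_zero]
  · rw [hx s hs, map_zero, zero_mul]

theorem mul_mem_homogeneous {i j : ℕ} {x y : S.Form} (hx : x ∈ S.homogeneous i)
    (hy : y ∈ S.homogeneous j) : x * y ∈ S.homogeneous (i + j) := by
  have key := coord_mul_eq_zero hx hy
  have key1 : ∀ s t : Fin 8, deg s + deg t ≠ i + j → x s * y t = 0 := key AlgEquiv.refl
  have key2 : ∀ (f g : A ≃ₐ[𝕜] A) (s t : Fin 8), deg s + deg t ≠ i + j → f (g (x s)) * y t = 0 :=
    fun f g => key (g.trans f)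
  have key3 : ∀ (f g h : A ≃ₐ[𝕜] A) (s t : Fin 8), deg s + deg t ≠ i + j →
      f (g (h (x s))) * y t = 0 := fun f g h => key ((h.trans g).trans f)
  refine forall_fin_eight ?_ ?_ ?_ ?_ ?_ ?_ ?_ ?_ <;> intro hw
  · rw [mul_zero_coord, key1 0 0 hw]
  · rw [mul_one_coord, key _ 0 1 hw, key1 1 0 hw, add_zero]
  · rw [mul_two_coord, key _ 0 2 hw, key1 2 0 hw, add_zero]
  · rw [mul_three_coord, key _ 0 3 hw, key1 3 0 hw, add_zero]
  · rw [mul_four_coord, key2 _ _ 0 4 hw, key1 4 0 hw, key _ 1 2 hw, key _ 2 1 hw]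
    simp
  · rw [mul_five_coord, key2 _ _ 0 5 hw, key1 5 0 hw, key _ 1 3 hw, key _ 3 1 hw]
    simp
  · rw [mul_six_coord, key2 _ _ 0 6 hw, key1 6 0 hw, key _ 2 3 hw, key _ 3 2 hw]
    simp
  · rw [mul_seven_coord, key3 _ _ _ 0 7 hw, key1 7 0 hw, key2 _ _ 1 6 hw,
      key2 _ _ 2 5 hw, key2 _ _ 3 4 hw, key _ 4 3 hw, key _ 5 2 hw, key _ 6 1 hw]
    simp

variable (S)

/-- The component of degree `k` of a form. -/
def component (k : ℕ) : S.Form →ₗ[𝕜] S.homogeneous k where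
  toFun x := ⟨fun i => if deg i = k then x i else 0, fun _ hi => if_neg hi⟩
  map_add' x y := Subtype.ext <| Form.ext fun i => by
    change (if deg i = k then x i + y i else 0) =
      (if deg i = k then x i else 0) + (if deg i = k then y i else 0)
    split_ifs <;> simp
  map_smul' r x := Subtype.ext <| Form.ext fun i => by
    change (if deg i = k then r • x i else 0) = r • (if deg i = k then x i else 0)
    split_ifs <;> simp

variable {S}

theorem component_coord (k : ℕ) (x : S.Form) (i : Fin 8) :
    (S.component k x : S.Form) i = if deg i = k then x i else 0 := rfl

theorem component_of_mem {k l : ℕ} {x : S.Form} (hx : x ∈ S.homogeneous k) :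
    (S.component l x : S.Form) = if k = l then x else 0 := by
  refine Form.ext fun i => ?_
  rw [component_coord]
  by_cases hi : deg i = k
  · by_cases h : k = l <;> simp [hi, h]
  · rw [hx i hi]
    by_cases h : k = l <;> simp [hx i hi, h]

theorem sum_component (x : S.Form) :
    ∑ k ∈ Finset.range 4, (S.component k x : S.Form) = x := by
  refine Form.ext fun i => ?_
  have h : ∀ f : ℕ → S.Form, (∑ k ∈ Finset.range 4, f k) i = ∑ k ∈ Finset.range 4, f k i :=
    fun f => Finset.sum_apply i _ f
  rw [h]
  simp only [component_coord]
  rw [Finset.sum_ite_eq, if_pos]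
  fin_cases i <;> simp [deg]

theorem homogeneous_eq_bot {k : ℕ} (hk : 3 < k) : S.homogeneous k = ⊥ := by
  rw [eq_bot_iff]
  intro x hx
  refine Form.ext fun i => hx i ?_
  have : deg i ≤ 3 := by fin_cases i <;> simp [deg]
  omega

instance : GradedAlgebra S.homogeneous where
  one_mem i hi := one_coord i (by rintro rfl; exact hi rfl)
  mul_mem _ _ _ _ hx hy := mul_mem_homogeneous hx hy
  decompose' x := ∑ k ∈ Finset.range 4, DirectSum.of (fun k => S.homogeneous k) k (S.component k x)
  left_inv x := by
    rw [map_sum]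
    simp only [DirectSum.coeAddMonoidHom_of]
    exact sum_component x
  right_inv x := by
    change (∑ k ∈ Finset.range 4, DirectSum.of (fun k => S.homogeneous k) k
      (S.component k (DirectSum.coeAddMonoidHom S.homogeneous x))) = x
    induction x using DirectSum.induction_on with
    | zero => simp
    | of l y =>
      rw [DirectSum.coeAddMonoidHom_of]
      by_cases hl : l < 4
      · rw [Finset.sum_eq_single_of_mem l (Finset.mem_range.2 hl)]
        · congr 1
          exact Subtype.ext (by rw [component_of_mem y.2, if_pos rfl])
        · intro k _ hk
          rw [show S.component k (y : S.Form) = 0 from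
            Subtype.ext (by rw [component_of_mem y.2, if_neg (Ne.symm hk)]; rfl), map_zero]
      · have hy : (y : S.Form) = 0 := by
          have h : ∀ z ∈ S.homogeneous l, z = 0 := by
            rw [homogeneous_eq_bot (by omega)]
            exact fun z hz => hz
          exact h y y.2
        rw [show y = 0 from Subtype.ext hy]
        simp
    | add x y hx hy =>
      rw [map_add]
      simp only [map_add, Finset.sum_add_distrib]
      rw [hx, hy]

variable (S)

/-- The exterior differential, given by `d(e_s a) = (-1)^|s| e_s da`. -/
def dForm (x : S.Form) : S.Form :=
  ![0, S.D₁ (x 0), S.D₂ (x 0), S.D₃ (x 0),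
    S.α • S.D₁ (x 2) - S.D₂ (x 1),
    S.β • S.D₁ (x 3) - S.D₃ (x 1),
    S.γ • S.D₂ (x 3) - S.D₃ (x 2),
    S.D₃ (x 4) - S.γ • S.D₂ (x 5) + (S.α * S.β) • S.D₁ (x 6)]

variable {S}

section coord
variable (x : S.Form)
@[simp] theorem d_zero_coord : S.dForm x 0 = 0 := rfl
@[simp] theorem d_one_coord : S.dForm x 1 = S.D₁ (x 0) := rfl
@[simp] theorem d_two_coord : S.dForm x 2 = S.D₂ (x 0) := rfl
@[simp] theorem d_three_coord : S.dForm x 3 = S.D₃ (x 0) := rfl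
@[simp] theorem d_four_coord : S.dForm x 4 = S.α • S.D₁ (x 2) - S.D₂ (x 1) := rfl
@[simp] theorem d_five_coord : S.dForm x 5 = S.β • S.D₁ (x 3) - S.D₃ (x 1) := rfl
@[simp] theorem d_six_coord : S.dForm x 6 = S.γ • S.D₂ (x 3) - S.D₃ (x 2) := rfl
@[simp] theorem d_seven_coord : S.dForm x 7 =
    S.D₃ (x 4) - S.γ • S.D₂ (x 5) + (S.α * S.β) • S.D₁ (x 6) := rfl
end coord

variable (S)

/-- `dForm` as a linear map. -/
def differential : S.Form →ₗ[𝕜] S.Form where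
  toFun := S.dForm
  map_add' x y := Form.ext <| by
    refine forall_fin_eight ?_ ?_ ?_ ?_ ?_ ?_ ?_ ?_ <;> simp <;> module
  map_smul' r x := Form.ext <| by
    refine forall_fin_eight ?_ ?_ ?_ ?_ ?_ ?_ ?_ ?_ <;> simp <;> module

variable {S}

theorem differential_apply (x : S.Form) : S.differential x = S.dForm x := rfl

theorem differential_mem {k : ℕ} {x : S.Form} (hx : x ∈ S.homogeneous k) :
    S.differential x ∈ S.homogeneous (k + 1) := by
  have h : ∀ i, deg i + 1 ≠ k + 1 → x i = 0 := fun i hi => hx i (by omega)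
  refine forall_fin_eight ?_ ?_ ?_ ?_ ?_ ?_ ?_ ?_ <;> intro hw <;> rw [differential_apply]
  · rfl
  · rw [d_one_coord, h 0 hw, map_zero]
  · rw [d_two_coord, h 0 hw, map_zero]
  · rw [d_three_coord, h 0 hw, map_zero]
  · rw [d_four_coord, h 1 hw, h 2 hw]; simp
  · rw [d_five_coord, h 1 hw, h 3 hw]; simp
  · rw [d_six_coord, h 2 hw, h 3 hw]; simp
  · rw [d_seven_coord, h 4 hw, h 5 hw, h 6 hw]; simp

theorem differential_differential (x : S.Form) : S.differential (S.differential x) = 0 := by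
  refine Form.ext <| forall_fin_eight ?_ ?_ ?_ ?_ ?_ ?_ ?_ ?_ <;>
    simp [differential_apply, S.D₂D₁, S.D₃D₁, S.D₃D₂]
  module

theorem differential_mul {k : ℕ} {x : S.Form} (hx : x ∈ S.homogeneous k) (y : S.Form) :
    S.differential (x * y) = S.differential x * y + (-1) ^ k * (x * S.differential y) := by
  obtain ⟨x', hx', hxx'⟩ : ∃ x' : S.Form, (∀ i, x' i = (-1 : 𝕜) ^ deg i • x i) ∧
      x' = (-1) ^ k * x := by
    refine ⟨fun i => (-1 : 𝕜) ^ deg i • x i, fun i => rfl, Form.ext fun i => ?_⟩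
    have h : ((-1) ^ k * x : S.Form) = (-1 : 𝕜) ^ k • x := by
      rw [Algebra.smul_def, map_pow, map_neg, map_one]
    rw [h, smul_coord]
    by_cases hi : deg i = k
    · rw [hi]
    · rw [hx i hi, smul_zero, smul_zero]
  rw [← mul_assoc, ← hxx']
  -- every operator with a lower index is moved to the left
  refine Form.ext <| forall_fin_eight ?_ ?_ ?_ ?_ ?_ ?_ ?_ ?_ <;>
    simp [differential_apply, hx', deg, S.leibniz₁, S.leibniz₂, S.leibniz₃, S.ν₂ν₁, S.ν₃ν₁, S.ν₃ν₂,
      S.D₂ν₁, S.D₃ν₁, S.D₃ν₂, S.ν₂D₁, S.ν₃D₁, S.ν₃D₂, add_mul, sub_mul, mul_add, mul_sub] <;> module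

variable (S)

/-- The form `e_s a` with a single nonzero coordinate. -/
def single (s : Fin 8) (a : A) : S.Form := Pi.single (M := fun _ => A) s a

variable {S}

@[simp] theorem single_coord (s : Fin 8) (a : A) (i : Fin 8) :
    S.single s a i = if i = s then a else 0 := by
  by_cases h : i = s
  · subst h
    rw [if_pos rfl]
    exact Pi.single_eq_same (M := fun _ => A) _ _
  · rw [if_neg h]
    exact Pi.single_eq_of_ne (M := fun _ => A) h _

theorem single_mem (s : Fin 8) (a : A) : S.single s a ∈ S.homogeneous (deg s) := by
  intro i hi
  rw [single_coord, if_neg (fun h => hi (by rw [h]))]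

variable (S)

/-- The inclusion of functions as forms of degree zero. -/
def ofAlg : A →ₐ[𝕜] S.Form :=
  AlgHom.ofLinearMap
    { toFun := S.single 0
      map_add' := fun a b => Form.ext <| by
        refine forall_fin_eight ?_ ?_ ?_ ?_ ?_ ?_ ?_ ?_ <;> simp
      map_smul' := fun r a => Form.ext <| by
        refine forall_fin_eight ?_ ?_ ?_ ?_ ?_ ?_ ?_ ?_ <;> simp }
    (Form.ext <| by
      refine forall_fin_eight ?_ ?_ ?_ ?_ ?_ ?_ ?_ ?_ <;> simp [one_coord])
    (fun a b => Form.ext <| by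
      refine forall_fin_eight ?_ ?_ ?_ ?_ ?_ ?_ ?_ ?_ <;> simp)

variable {S}

theorem ofAlg_apply (a : A) : S.ofAlg a = S.single 0 a := rfl

theorem ofAlg_injective : Function.Injective S.ofAlg := fun a b h => by
  have := congrArg (fun x : S.Form => x 0) h
  simpa [ofAlg_apply] using this

theorem mem_homogeneous_zero {x : S.Form} (hx : x ∈ S.homogeneous 0) : x = S.single 0 (x 0) := by
  refine Form.ext <| forall_fin_eight ?_ ?_ ?_ ?_ ?_ ?_ ?_ ?_ <;>
    first | exact hx _ (by decide) | rfl

theorem mem_homogeneous_one {x : S.Form} (hx : x ∈ S.homogeneous 1) :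
    x = S.single 1 (x 1) + S.single 2 (x 2) + S.single 3 (x 3) := by
  refine Form.ext <| forall_fin_eight ?_ ?_ ?_ ?_ ?_ ?_ ?_ ?_ <;>
    first | simp; done | (rw [hx _ (by decide)]; simp)

theorem mem_homogeneous_two {x : S.Form} (hx : x ∈ S.homogeneous 2) :
    x = S.single 4 (x 4) + S.single 5 (x 5) + S.single 6 (x 6) := by
  refine Form.ext <| forall_fin_eight ?_ ?_ ?_ ?_ ?_ ?_ ?_ ?_ <;>
    first | simp; done | (rw [hx _ (by decide)]; simp)

theorem mem_homogeneous_three {x : S.Form} (hx : x ∈ S.homogeneous 3) :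
    x = S.single 7 (x 7) := by
  refine Form.ext <| forall_fin_eight ?_ ?_ ?_ ?_ ?_ ?_ ?_ ?_ <;>
    first | simp; done | (rw [hx _ (by decide)]; simp)

theorem range_ofAlg : Subalgebra.toSubmodule S.ofAlg.range = S.homogeneous 0 := by
  ext x
  constructor
  · rintro ⟨a, rfl⟩
    exact single_mem 0 a
  · intro hx
    exact ⟨x 0, (mem_homogeneous_zero hx).symm⟩

theorem differential_u₁ : S.differential (S.ofAlg S.u₁) = S.single 1 1 :=
  Form.ext <| by
    refine forall_fin_eight ?_ ?_ ?_ ?_ ?_ ?_ ?_ ?_ <;>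
      simp [differential_apply, ofAlg_apply, S.D₁u₁, S.D₂u₁, S.D₃u₁]

theorem differential_u₂ : S.differential (S.ofAlg S.u₂) = S.single 2 1 :=
  Form.ext <| by
    refine forall_fin_eight ?_ ?_ ?_ ?_ ?_ ?_ ?_ ?_ <;>
      simp [differential_apply, ofAlg_apply, S.D₁u₂, S.D₂u₂, S.D₃u₂]

theorem differential_u₃ : S.differential (S.ofAlg S.u₃) = S.single 3 1 :=
  Form.ext <| by
    refine forall_fin_eight ?_ ?_ ?_ ?_ ?_ ?_ ?_ ?_ <;>
      simp [differential_apply, ofAlg_apply, S.D₁u₃, S.D₂u₃, S.D₃u₃]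

theorem ofAlg_mul_mem {a : A} {n : ℕ} {x : S.Form}
    (hx : x ∈ (S.homogeneous 0).map S.differential ^ n) :
    S.ofAlg a * x ∈ S.homogeneous 0 * (S.homogeneous 0).map S.differential ^ n :=
  Submodule.mul_mem_mul (single_mem 0 a) hx

/-- Every form is generated by functions and their differentials, since `duᵢ = eᵢ` and the `νᵢ` are
invertible. -/
theorem homogeneous_eq_mul_pow (n : ℕ) :
    S.homogeneous n = S.homogeneous 0 * (S.homogeneous 0).map S.differential ^ n := by
  have hd : ∀ a, S.differential (S.ofAlg a) ∈ (S.homogeneous 0).map S.differential :=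
    fun a => ⟨_, single_mem 0 a, rfl⟩
  have h₁ : S.single 1 1 ∈ (S.homogeneous 0).map S.differential := differential_u₁ (S := S) ▸ hd _
  have h₂ : S.single 2 1 ∈ (S.homogeneous 0).map S.differential := differential_u₂ (S := S) ▸ hd _
  have h₃ : S.single 3 1 ∈ (S.homogeneous 0).map S.differential := differential_u₃ (S := S) ▸ hd _
  apply le_antisymm
  · intro x hx
    match n with
    | 0 =>
      rw [pow_zero, mul_one]
      exact hx
    | 1 =>
      rw [mem_homogeneous_one hx]
      have e₁ : ∀ a, S.single 1 a = S.ofAlg (S.ν₁.symm a) * S.single 1 1 := fun a =>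
        Form.ext <| by
          refine forall_fin_eight ?_ ?_ ?_ ?_ ?_ ?_ ?_ ?_ <;> simp [ofAlg_apply]
      have e₂ : ∀ a, S.single 2 a = S.ofAlg (S.ν₂.symm a) * S.single 2 1 := fun a =>
        Form.ext <| by
          refine forall_fin_eight ?_ ?_ ?_ ?_ ?_ ?_ ?_ ?_ <;> simp [ofAlg_apply]
      have e₃ : ∀ a, S.single 3 a = S.ofAlg (S.ν₃.symm a) * S.single 3 1 := fun a =>
        Form.ext <| by
          refine forall_fin_eight ?_ ?_ ?_ ?_ ?_ ?_ ?_ ?_ <;> simp [ofAlg_apply]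
      rw [e₁, e₂, e₃]
      refine add_mem (add_mem ?_ ?_) ?_ <;> refine ofAlg_mul_mem ?_ <;> rwa [pow_one]
    | 2 =>
      rw [mem_homogeneous_two hx]
      have e₄ : ∀ a, S.single 4 a =
          S.ofAlg (S.ν₂.symm (S.ν₁.symm a)) * (S.single 1 1 * S.single 2 1) := fun a =>
        Form.ext <| by
          refine forall_fin_eight ?_ ?_ ?_ ?_ ?_ ?_ ?_ ?_ <;> simp [ofAlg_apply]
      have e₅ : ∀ a, S.single 5 a =
          S.ofAlg (S.ν₃.symm (S.ν₁.symm a)) * (S.single 1 1 * S.single 3 1) := fun a =>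
        Form.ext <| by
          refine forall_fin_eight ?_ ?_ ?_ ?_ ?_ ?_ ?_ ?_ <;> simp [ofAlg_apply]
      have e₆ : ∀ a, S.single 6 a =
          S.ofAlg (S.ν₃.symm (S.ν₂.symm a)) * (S.single 2 1 * S.single 3 1) := fun a =>
        Form.ext <| by
          refine forall_fin_eight ?_ ?_ ?_ ?_ ?_ ?_ ?_ ?_ <;> simp [ofAlg_apply]
      rw [e₄, e₅, e₆]
      refine add_mem (add_mem ?_ ?_) ?_ <;> refine ofAlg_mul_mem ?_ <;> rw [pow_two] <;>
        refine Submodule.mul_mem_mul ?_ ?_ <;> assumption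
    | 3 =>
      rw [mem_homogeneous_three hx]
      have e₇ : ∀ a, S.single 7 a = S.ofAlg (S.ν₃.symm (S.ν₂.symm (S.ν₁.symm a))) *
          (S.single 1 1 * S.single 2 1 * S.single 3 1) := fun a =>
        Form.ext <| by
          refine forall_fin_eight ?_ ?_ ?_ ?_ ?_ ?_ ?_ ?_ <;> simp [ofAlg_apply]
      rw [e₇, pow_succ, pow_two]
      exact Submodule.mul_mem_mul (single_mem 0 _)
        (Submodule.mul_mem_mul (Submodule.mul_mem_mul h₁ h₂) h₃)
    | m + 4 =>
      rw [homogeneous_eq_bot (by omega), Submodule.mem_bot] at hx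
      rw [hx]
      exact zero_mem _
  · have hmap : (S.homogeneous 0).map S.differential ≤ S.homogeneous 1 := by
      rintro _ ⟨x, hx, rfl⟩
      exact differential_mem hx
    have hpow : ∀ m, (S.homogeneous 0).map S.differential ^ m ≤ S.homogeneous m := by
      intro m
      induction m with
      | zero =>
        rw [pow_zero, Submodule.one_le]
        exact SetLike.GradedOne.one_mem
      | succ m ih =>
        rw [pow_succ, Submodule.mul_le]
        exact fun x hx y hy => mul_mem_homogeneous (ih hx) (hmap hy)
    rw [Submodule.mul_le]
    intro x hx y hy
    have := mul_mem_homogeneous hx (hpow n hy)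
    rwa [zero_add] at this

variable (S)

/-- The differential calculus of a frame. -/
def calculus : DiffCalculus 𝕜 A where
  Ω := S.Form
  form := S.homogeneous
  d := S.differential
  d_mem _ _ hx := differential_mem hx
  leibniz _ _ y hx := differential_mul hx y
  d_d := differential_differential
  ι := S.ofAlg
  ι_injective := ofAlg_injective
  range_ι := range_ofAlg
  density := homogeneous_eq_mul_pow

end SkewFrame

/-! ### Integrability from a nondegenerate pairing -/

namespace DiffCalculus

variable {𝕜 : Type u} {A : Type v} [Field 𝕜] [Ring A] [Algebra 𝕜 A] (K : DiffCalculus 𝕜 A)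

/-- The wedge product into a prescribed degree. -/
def wedgeTo {k m n : ℕ} (h : k + m = n) (ω : K.form k) (η : K.form m) : K.form n :=
  ⟨ω * η, h ▸ SetLike.mul_mem_graded ω.2 η.2⟩

variable {K}

/-- The map `ω ↦ (η ↦ π(ω ∧ η))` from forms to integral forms of complementary degree. -/
def pairing {n : ℕ} (π : K.integralForm n) {k m : ℕ} (h : k + m = n) :
    K.form k →ₗ[𝕜] K.integralForm m where
  toFun ω := ⟨{ toFun := fun η => π.1 (K.wedgeTo h ω η)
                map_add' := fun η η' => by
                  rw [← map_add]; congr 1; ext; simp [wedgeTo, mul_add]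
                map_smul' := fun c η => by
                  rw [RingHom.id_apply, ← map_smul]; congr 1; ext; simp [wedgeTo] }, by
    intro η b
    change π.1 (K.wedgeTo h ω (K.act 1 η b)) = π.1 (K.wedgeTo h ω η) * b
    rw [← integralForm_act]
    congr 1; ext; simp [wedgeTo, act, mul_assoc]⟩
  map_add' ω ω' := by
    ext η
    change π.1 (K.wedgeTo h (ω + ω') η) = π.1 (K.wedgeTo h ω η) + π.1 (K.wedgeTo h ω' η)
    rw [← map_add]; congr 1; ext; simp [wedgeTo, add_mul]
  map_smul' c ω := by
    ext η
    change π.1 (K.wedgeTo h (c • ω) η) = c • π.1 (K.wedgeTo h ω η)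
    rw [← map_smul]; congr 1; ext; simp [wedgeTo]

/-- An odd-dimensional calculus is integrable as soon as its top forms carry a twisted-linear functional
with nondegenerate pairings: `Θ` is the pairing, the divergence is `ω ↦ π(dω)` transported by `Θ`, and
all compatibilities are instances of the Leibniz rule and of `d² = 0`. Odd dimension makes the signs
cancel without rescaling `Θ`. -/
theorem isIntegrable_of_pairing {n : ℕ} (hn : Odd n) (hn' : 1 < n) (π : K.integralForm n) (ν : A ≃ₐ[𝕜] A)
    (hν : ∀ (a : A) (ω : K.form n), π.1 (K.act a ω 1) = ν a * π.1 ω)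
    (hπ : ∀ (k m : ℕ) (h : k + m = n), Function.Bijective (pairing π h)) :
    K.IsIntegrable n := by
  obtain ⟨l, rfl⟩ := hn
  let Θ : ∀ k m : ℕ, k + m = 2 * l + 1 → (K.form k ≃ₗ[𝕜] K.integralForm m) :=
    fun k m h => LinearEquiv.ofBijective (pairing π h) (hπ k m h)
  have hΘ : ∀ (k m : ℕ) (h : k + m = 2 * l + 1) (ω : K.form k) (η : K.form m),
      (Θ k m h ω).1 η = π.1 (K.wedgeTo h ω η) := fun _ _ _ _ _ => rfl
  have hact : ∀ (k m : ℕ) (h : k + m = 2 * l + 1) (a b : A) (ω : K.form k),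
      Θ k m h (K.act a ω b) = dualAct (ν a) (Θ k m h ω) b := by
    intro k m h a b ω
    ext η
    change π.1 (K.wedgeTo h (K.act a ω b) η) = ν a * π.1 (K.wedgeTo h ω (K.act b η 1))
    rw [← hν]
    congr 1; ext; simp [wedgeTo, act, mul_assoc]
  -- the divergence sends the integral form represented by `ω` to the density of `dω`
  let D : K.Divergence :=
    { toFun := π.1 ∘ₗ (K.d.restrict (p := K.form (2 * l)) (q := K.form (2 * l + 1))
        (fun ω hω => K.d_mem _ ω hω)) ∘ₗ (Θ (2 * l) 1 rfl).symm.toLinearMap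
      leibniz := by
        intro φ a
        obtain ⟨ω, rfl⟩ := (Θ (2 * l) 1 rfl).surjective φ
        have h₁ := hact (2 * l) 1 rfl 1 a ω
        rw [map_one] at h₁
        rw [← h₁]
        simp only [LinearMap.comp_apply, LinearEquiv.coe_coe, LinearEquiv.symm_apply_apply]
        rw [hΘ, ← integralForm_act, ← map_add]
        congr 1
        ext
        simp only [LinearMap.coe_restrict_apply, act, wedgeTo, diffZero, Submodule.coe_add,
          map_one, one_mul]
        rw [K.leibniz _ _ _ ω.2, (even_two_mul l).neg_one_pow, one_mul] }
  have hD : ∀ ω : K.form (2 * l), D.toFun (Θ (2 * l) 1 rfl ω) = π.1 (K.diff ω) := by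
    intro ω
    change π.1 _ = _
    congr 1
    ext
    simp [diff]
  have hcomm : ∀ (k m : ℕ) (h : k + (m + 1) = 2 * l + 1) (h' : (k + 1) + m = 2 * l + 1)
      (ω : K.form k), Θ (k + 1) m h' (K.diff ω) = D.ext m (Θ k (m + 1) h ω) := by
    intro k m h h' ω
    ext η
    change π.1 (K.wedgeTo h' (K.diff ω) η) =
      D.toFun (dualWedge (Θ k (m + 1) h ω) η) +
        (-1) ^ (m + 1) * π.1 (K.wedgeTo h ω (K.diff η))
    have h₁ : dualWedge (Θ k (m + 1) h ω) η =
        Θ (2 * l) 1 rfl (K.wedgeTo (by omega) ω η) := by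
      ext ρ
      change π.1 (K.wedgeTo h ω (K.wedge η ρ)) = π.1 (K.wedgeTo rfl (K.wedgeTo _ ω η) ρ)
      congr 1; ext; simp [wedgeTo, wedge, mul_assoc]
    have h₂ : K.diff (K.wedgeTo (n := 2 * l) (by omega) ω η) =
        K.wedgeTo h' (K.diff ω) η + ((-1 : 𝕜) ^ k) • K.wedgeTo h ω (K.diff η) := by
      ext
      simp only [diff, wedgeTo, Submodule.coe_add, Submodule.coe_smul]
      rw [K.leibniz _ _ _ ω.2, Algebra.smul_def, map_pow, map_neg, map_one]
    have h₃ : (-1 : A) ^ (m + 1) = - (-1) ^ k := by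
      have : m + 1 + k = 2 * l + 1 := by omega
      rcases Nat.even_or_odd k with e | e
      · have : Odd (m + 1) := by
          obtain ⟨j, rfl⟩ := e; exact ⟨l - j, by omega⟩
        rw [e.neg_one_pow, this.neg_one_pow]
      · have : Even (m + 1) := by
          obtain ⟨j, rfl⟩ := e; exact ⟨l - j, by omega⟩
        rw [e.neg_one_pow, this.neg_one_pow, neg_neg]
    rw [h₁, hD, h₂, map_add, map_smul, h₃, Algebra.smul_def, map_pow, map_neg, map_one]
    noncomm_ring
  refine ⟨D, ?_, ν, Θ, hact, hcomm⟩
  intro φ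
  obtain ⟨k, rfl⟩ : ∃ k, l = k + 1 := ⟨l - 1, by omega⟩
  obtain ⟨ω, rfl⟩ := (Θ (2 * k + 1) 2 (by omega)).surjective φ
  rw [← hcomm (2 * k + 1) 1 (by omega) (by omega)]
  refine (hD (K.diff ω)).trans ?_
  rw [show K.diff (K.diff ω) = 0 from Subtype.ext (K.d_d ω), map_zero]

end DiffCalculus

/-! ### The calculus of a frame is integrable -/

namespace SkewFrame

variable {𝕜 : Type u} {A : Type v} [Field 𝕜] [Ring A] [Algebra 𝕜 A] (S : SkewFrame 𝕜 A)

/-- The element of `S.Form` underlying a form of the calculus. -/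
def toForm {k : ℕ} (ω : S.calculus.form k) : S.Form := ω.1

/-- A homogeneous element of `S.Form` as a form of the calculus. -/
def ofForm {k : ℕ} (x : S.Form) (hx : x ∈ S.homogeneous k) : S.calculus.form k := ⟨x, hx⟩

/-- The coefficient `a` of `e₁ e₂ e₃ a`. -/
def volumeCoeff : S.calculus.integralForm 3 :=
  ⟨{ toFun := fun ω => S.toForm ω 7
     map_add' := fun _ _ => rfl
     map_smul' := fun _ _ => rfl }, fun ω b => by
    change (S.ofAlg 1 * S.toForm ω * S.ofAlg b) 7 = S.toForm ω 7 * b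
    rw [map_one, one_mul]
    simp [ofAlg_apply]⟩

variable {S}

theorem volumeCoeff_act (a : A) (ω : S.calculus.form 3) :
    S.volumeCoeff.1 (S.calculus.act a ω 1) =
      (S.ν₃.trans (S.ν₂.trans S.ν₁)) a * S.volumeCoeff.1 ω := by
  change (S.ofAlg a * S.toForm ω * S.ofAlg 1) 7 = _ * S.toForm ω 7
  rw [map_one, mul_one]
  simp [ofAlg_apply]

theorem integralForm_single {m : ℕ} (φ : S.calculus.integralForm m) (s : Fin 8)
    (a : A) (hm : S.single s a ∈ S.homogeneous m) (h1 : S.single s 1 ∈ S.homogeneous m) :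
    φ.1 (S.ofForm _ hm) = φ.1 (S.ofForm _ h1) * a := by
  rw [← DiffCalculus.integralForm_act]
  congr 1
  apply Subtype.ext
  change S.single s a = S.ofAlg 1 * S.single s 1 * S.ofAlg a
  rw [map_one, one_mul]
  refine Form.ext <| forall_fin_eight ?_ ?_ ?_ ?_ ?_ ?_ ?_ ?_ <;> fin_cases s <;> simp [ofAlg_apply]

theorem pairing_bijective (k m : ℕ) (h : k + m = 3) :
    Function.Bijective (DiffCalculus.pairing S.volumeCoeff h) := by
  have hsingle : ∀ {m : ℕ} (s : Fin 8) (hs : deg s = m) (a : A),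
      S.single s a ∈ S.homogeneous m := fun s hs a => hs ▸ single_mem s a
  have happ : ∀ (ω : S.calculus.form k) (η : S.calculus.form m),
    (DiffCalculus.pairing S.volumeCoeff h ω).1 η = (S.toForm ω * S.toForm η) 7 :=
    fun _ _ => rfl
  have hα := S.α_ne
  have hβ := S.β_ne
  have hγ := S.γ_ne
  constructor
  · rw [injective_iff_map_eq_zero]
    intro ω hω
    have key : ∀ (s : Fin 8) (hs : deg s = m), (S.toForm ω * S.single s 1) 7 = 0 := by
      intro s hs
      have := happ ω (S.ofForm (S.single s 1) (hsingle s hs 1))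
      rw [hω] at this
      exact this.symm
    have hk' : S.toForm ω ∈ S.homogeneous k := ω.2
    refine Subtype.ext ?_
    change S.toForm ω = 0
    have h0 : ∀ s, S.single s 0 = 0 := fun s => by
      refine Form.ext fun i => ?_
      rw [single_coord, ite_self, zero_coord]
    obtain ⟨rfl, rfl⟩ | ⟨rfl, rfl⟩ | ⟨rfl, rfl⟩ | ⟨rfl, rfl⟩ :
      (k = 0 ∧ m = 3) ∨ (k = 1 ∧ m = 2) ∨ (k = 2 ∧ m = 1) ∨ (k = 3 ∧ m = 0) := by omega
    · have h₇ := key 7 rfl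
      simp at h₇
      rw [mem_homogeneous_zero hk', h₇, h0]
    · have h₄ := key 4 rfl
      have h₅ := key 5 rfl
      have h₆ := key 6 rfl
      simp [hα, hβ, hγ] at h₄ h₅ h₆
      rw [mem_homogeneous_one hk', h₄, h₅, h₆]
      simp [h0]
    · have h₁ := key 1 rfl
      have h₂ := key 2 rfl
      have h₃ := key 3 rfl
      simp [hα, hβ, hγ] at h₁ h₂ h₃
      rw [mem_homogeneous_two hk', h₁, h₂, h₃]
      simp [h0]
    · have h₀ := key 0 rfl
      simp at h₀
      rw [mem_homogeneous_three hk', h₀, h0]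
  · intro φ
    have hφ : ∀ s, ∃ b : A, ∀ (hs : deg s = m) (a : A),
        φ.1 (S.ofForm (S.single s a) (hsingle s hs a)) = b * a := by
      intro s
      by_cases hs : deg s = m
      · exact ⟨_, fun _ a => integralForm_single φ s a (hsingle s hs a) (hsingle s hs 1)⟩
      · exact ⟨0, fun h => absurd h hs⟩
    choose c hφ using hφ
    -- a right linear map is determined by its values on the basis forms
    suffices H : ∃ ω : S.Form, ω ∈ S.homogeneous k ∧
        ∀ s a, deg s = m → (ω * S.single s a) 7 = c s * a by
      obtain ⟨ω, hk, hω⟩ := H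
      refine ⟨S.ofForm ω hk, Subtype.ext <| LinearMap.ext fun η => ?_⟩
      rw [happ]
      have hη' : S.toForm η ∈ S.homogeneous m := η.2
      change (ω * S.toForm η) 7 = _
      have add3 : ∀ (s t r : Fin 8) (hs : deg s = m) (ht : deg t = m) (hr : deg r = m) (a b d : A)
        (e : S.toForm η = S.single s a + S.single t b + S.single r d), (ω * S.toForm η) 7 = φ.1 η := by
        intro s t r hs ht hr a b d e
        have : η = S.ofForm _ (hsingle s hs a) +
            S.ofForm _ (hsingle t ht b) + S.ofForm _ (hsingle r hr d) := Subtype.ext e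
        rw [e, this, map_add, map_add, hφ s hs, hφ t ht, hφ r hr, mul_add, mul_add, add_coord, add_coord,
          hω s a hs, hω t b ht, hω r d hr]
      have one : ∀ (s : Fin 8) (hs : deg s = m) (a : A)
        (e : S.toForm η = S.single s a), (ω * S.toForm η) 7 = φ.1 η := by
        intro s hs a e
        have : η = S.ofForm _ (hsingle s hs a) := Subtype.ext e
        rw [e, this, hφ s hs, hω s a hs]
      have hm : m = 0 ∨ m = 1 ∨ m = 2 ∨ m = 3 := by omega
      rcases hm with rfl | rfl | rfl | rfl
      · exact one 0 rfl _ (mem_homogeneous_zero hη')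
      · exact add3 1 2 3 rfl rfl rfl _ _ _ (mem_homogeneous_one hη')
      · exact add3 4 5 6 rfl rfl rfl _ _ _ (mem_homogeneous_two hη')
      · exact one 7 rfl _ (mem_homogeneous_three hη')
    have mem3 : ∀ (s t r : Fin 8) (hs : deg s = k) (ht : deg t = k) (hr : deg r = k) (a b d : A),
      S.single s a + S.single t b + S.single r d ∈ S.homogeneous k := fun s t r hs ht hr a b d =>
        add_mem (add_mem (hsingle s hs a) (hsingle t ht b)) (hsingle r hr d)
    -- each coordinate of the solution is read off from the complementary basis form
    obtain ⟨rfl, rfl⟩ | ⟨rfl, rfl⟩ | ⟨rfl, rfl⟩ | ⟨rfl, rfl⟩ :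
      (k = 0 ∧ m = 3) ∨ (k = 1 ∧ m = 2) ∨ (k = 2 ∧ m = 1) ∨ (k = 3 ∧ m = 0) := by omega
    · refine ⟨S.single 0 (S.ν₃.symm (S.ν₂.symm (S.ν₁.symm (c 7)))), hsingle 0 rfl _, ?_⟩
      intro s a hs
      fin_cases s <;> simp [deg] at hs ⊢
    · refine ⟨S.single 1 (S.ν₃.symm (S.ν₂.symm (c 6))) +
        S.single 2 (S.ν₃.symm (S.ν₁.symm (-S.α⁻¹ • c 5))) +
        S.single 3 (S.ν₂.symm (S.ν₁.symm ((S.β * S.γ)⁻¹ • c 4))), mem3 1 2 3 rfl rfl rfl _ _ _, ?_⟩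
      intro s a hs
      fin_cases s <;> simp [deg, smul_smul, hα, hβ, hγ, -mul_inv_rev] at hs ⊢
    · refine ⟨S.single 4 (S.ν₃.symm (c 3)) +
        S.single 5 (S.ν₂.symm (-S.γ⁻¹ • c 2)) +
        S.single 6 (S.ν₁.symm ((S.α * S.β)⁻¹ • c 1)), mem3 4 5 6 rfl rfl rfl _ _ _, ?_⟩
      intro s a hs
      fin_cases s <;> simp [deg, smul_smul, hα, hβ, hγ, -mul_inv_rev] at hs ⊢
    · refine ⟨S.single 7 (c 0), hsingle 7 rfl _, ?_⟩
      intro s a hs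
      fin_cases s <;> simp [deg] at hs ⊢

theorem calculus_isIntegrable : S.calculus.IsIntegrable 3 :=
  DiffCalculus.isIntegrable_of_pairing (by decide) (by decide) S.volumeCoeff _ volumeCoeff_act
    pairing_bijective

theorem calculus_hasDimension [Nontrivial A] : S.calculus.HasDimension 3 := by
  constructor
  · intro h
    have h7 : S.single 7 1 = 0 := (Submodule.eq_bot_iff _).1 h _ (single_mem 7 1)
    have := congrArg (fun x : S.Form => x 7) h7
    simp at this
  · exact fun m hm => homogeneous_eq_bot hm

theorem calculus_isConnected
    (h : ∀ a, S.D₁ a = 0 → S.D₂ a = 0 → S.D₃ a = 0 → a ∈ Set.range (algebraMap 𝕜 A)) :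
    S.calculus.IsConnected := by
  intro a
  constructor
  · intro ha
    have ha' : S.differential (S.ofAlg a) = 0 := ha
    refine h a ?_ ?_ ?_
    · exact congrArg (fun x : S.Form => x 1) ha'
    · exact congrArg (fun x : S.Form => x 2) ha'
    · exact congrArg (fun x : S.Form => x 3) ha'
  · rintro ⟨r, rfl⟩
    have hd : S.differential 1 = 0 := by
      have := differential_mul (S := S) (x := 1) (k := 0) SetLike.GradedOne.one_mem 1
      simpa using this
    change S.differential (S.ofAlg _) = 0
    rw [AlgHom.commutes, Algebra.algebraMap_eq_smul_one, map_smul, hd, smul_zero]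

end SkewFrame

/-! ### Coordinates and universal property of a skew PBW extension -/

section monomialMap

variable {𝕜 : Type u} {A : Type v} [Field 𝕜] [Ring A] [Algebra 𝕜 A]

/-- The map `(f_{ij}) ↦ ∑ f_{ij}(t) x₁ⁱ x₂ʲ`. -/
def monomialMap (ι : 𝕜[X] →ₐ[𝕜] A) (x₁ x₂ : A) : (ℕ × ℕ →₀ 𝕜[X]) →ₗ[𝕜] A :=
  Finsupp.lsum 𝕜 fun p => LinearMap.mulRight 𝕜 (x₁ ^ p.1 * x₂ ^ p.2) ∘ₗ ι.toLinearMap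

theorem monomialMap_single (ι : 𝕜[X] →ₐ[𝕜] A) (x₁ x₂ : A) (i j : ℕ) (f : 𝕜[X]) :
    monomialMap ι x₁ x₂ (Finsupp.single (i, j) f) = ι f * (x₁ ^ i * x₂ ^ j) := by
  simp [monomialMap, mul_assoc]

end monomialMap

namespace SkewPBWData.IsExtension

variable {𝕜 : Type u} {A : Type v} [Field 𝕜] [Ring A] [Algebra 𝕜 A] {P : SkewPBWData 𝕜}
  {ι : 𝕜[X] →ₐ[𝕜] A} {x₁ x₂ : A}

theorem monomialMap_bijective (hA : P.IsExtension ι x₁ x₂) :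
    Function.Bijective (monomialMap ι x₁ x₂) := by
  have h := hA.isSkewPBW.basis
  have key : (fun f : (Fin 2 → ℕ) →₀ 𝕜[X] =>
      f.sum fun α r => (ι : 𝕜[X] →+* A) r * orderedMonomial ![x₁, x₂] α) =
      monomialMap ι x₁ x₂ ∘ Finsupp.equivMapDomain (finTwoArrowEquiv ℕ) := by
    funext f
    simp only [Function.comp_apply, monomialMap, Finsupp.lsum_apply, Finsupp.sum_equivMapDomain]
    refine Finsupp.sum_congr fun α _ => ?_
    simp [orderedMonomial, List.ofFn_succ, mul_assoc]
  rw [key] at h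
  exact (Function.Bijective.of_comp_iff _ (Finsupp.equivCongrLeft (finTwoArrowEquiv ℕ)).bijective).1 h

/-- The basis property in the form `𝕜[t]^(ℕ × ℕ) ≃ A`, `(f_{ij}) ↦ ∑ f_{ij}(t) x₁ⁱ x₂ʲ`. -/
def coordEquiv (hA : P.IsExtension ι x₁ x₂) : (ℕ × ℕ →₀ 𝕜[X]) ≃ₗ[𝕜] A :=
  LinearEquiv.ofBijective (monomialMap ι x₁ x₂) hA.monomialMap_bijective

theorem coordEquiv_single (hA : P.IsExtension ι x₁ x₂) (i j : ℕ) (f : 𝕜[X]) :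
    hA.coordEquiv (Finsupp.single (i, j) f) = ι f * (x₁ ^ i * x₂ ^ j) :=
  monomialMap_single ι x₁ x₂ i j f

theorem coordEquiv_symm_apply (hA : P.IsExtension ι x₁ x₂) (i j : ℕ) (f : 𝕜[X]) :
    hA.coordEquiv.symm (ι f * (x₁ ^ i * x₂ ^ j)) = Finsupp.single (i, j) f := by
  rw [← hA.coordEquiv_single, LinearEquiv.symm_apply_apply]

theorem linearMap_ext (hA : P.IsExtension ι x₁ x₂) {M : Type*} [AddCommGroup M] [Module 𝕜 M]
    {f g : A →ₗ[𝕜] M}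
    (h : ∀ n i j, f (ι X ^ n * (x₁ ^ i * x₂ ^ j)) = g (ι X ^ n * (x₁ ^ i * x₂ ^ j))) : f = g := by
  have : f ∘ₗ hA.coordEquiv.toLinearMap = g ∘ₗ hA.coordEquiv.toLinearMap := by
    refine Finsupp.lhom_ext' fun ⟨i, j⟩ => Polynomial.lhom_ext' fun n => LinearMap.ext_ring ?_
    simp only [LinearMap.comp_apply, LinearEquiv.coe_coe, Finsupp.lsingle_apply, coordEquiv_single,
      ← X_pow_eq_monomial, map_pow, h]
  refine LinearMap.ext fun a => ?_
  have := LinearMap.congr_fun this (hA.coordEquiv.symm a)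
  simpa using this

theorem rel_smul₁ (hA : P.IsExtension ι x₁ x₂) (m : A) :
    x₁ * (ι X * m) = P.a₁ • (ι X * (x₁ * m)) + P.b₁ • (x₁ * m) + ι P.p₁ * m := by
  rw [← mul_assoc, hA.rel₁, map_add, map_mul, ← Polynomial.algebraMap_eq, AlgHom.commutes,
    AlgHom.commutes, Algebra.smul_def, Algebra.smul_def]
  noncomm_ring

theorem rel_smul₂ (hA : P.IsExtension ι x₁ x₂) (m : A) :
    x₂ * (ι X * m) = P.a₂ • (ι X * (x₂ * m)) + P.b₂ • (x₂ * m) + ι P.p₂ * m := by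
  rw [← mul_assoc, hA.rel₂, map_add, map_mul, ← Polynomial.algebraMap_eq, AlgHom.commutes,
    AlgHom.commutes, Algebra.smul_def, Algebra.smul_def]
  noncomm_ring

theorem rel_smul₁₂ (hA : P.IsExtension ι x₁ x₂) (m : A) :
    x₂ * (x₁ * m) = P.c • (x₁ * (x₂ * m)) + P.q₀ • m + P.q₁ • (x₁ * m) + P.q₂ • (x₂ * m) := by
  rw [← mul_assoc, hA.rel₁₂, Algebra.smul_def P.q₀]
  simp only [add_mul, smul_mul_assoc, mul_assoc]

/-- `A` is presented by its generators `t, x₁, x₂` and the three relations. The linear map prescribed on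
the basis commutes with left multiplication by each generator, because the relations rewrite the product
of a generator and a monomial in the same way in `A` and in `B`. -/
theorem exists_algHom (hA : P.IsExtension ι x₁ x₂) {B : Type*} [Ring B] [Algebra 𝕜 B] (T Y₁ Y₂ : B)
    (h₁ : Y₁ * T = P.a₁ • (T * Y₁) + P.b₁ • Y₁ + aeval T P.p₁)
    (h₂ : Y₂ * T = P.a₂ • (T * Y₂) + P.b₂ • Y₂ + aeval T P.p₂)
    (h₁₂ : Y₂ * Y₁ = P.c • (Y₁ * Y₂) + algebraMap 𝕜 B P.q₀ + P.q₁ • Y₁ + P.q₂ • Y₂) :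
    ∃ φ : A →ₐ[𝕜] B, φ (ι X) = T ∧ φ x₁ = Y₁ ∧ φ x₂ = Y₂ := by
  obtain ⟨L, hL⟩ : ∃ L : A →ₗ[𝕜] B, ∀ f i j, L (ι f * (x₁ ^ i * x₂ ^ j)) =
      aeval T f * (Y₁ ^ i * Y₂ ^ j) := by
    refine ⟨monomialMap (aeval T) Y₁ Y₂ ∘ₗ hA.coordEquiv.symm.toLinearMap, fun f i j => ?_⟩
    rw [LinearMap.comp_apply, LinearEquiv.coe_coe, coordEquiv_symm_apply, monomialMap_single]
  have hpow : ∀ n i j, L (ι X ^ n * (x₁ ^ i * x₂ ^ j)) = T ^ n * (Y₁ ^ i * Y₂ ^ j) := by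
    intro n i j
    rw [← map_pow, hL, map_pow, aeval_X]
  have hmon : ∀ i j, L (x₁ ^ i * x₂ ^ j) = Y₁ ^ i * Y₂ ^ j := by
    intro i j
    simpa using hpow 0 i j
  have hι : ∀ f a, L (ι f * a) = aeval T f * L a := by
    intro f a
    have : L ∘ₗ LinearMap.mulLeft 𝕜 (ι f) = LinearMap.mulLeft 𝕜 (aeval T f) ∘ₗ L := by
      refine hA.linearMap_ext fun n i j => ?_
      simp only [LinearMap.comp_apply, LinearMap.mulLeft_apply]
      rw [hpow, ← mul_assoc, ← map_pow, ← map_mul, hL, map_mul, map_pow, aeval_X, mul_assoc]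
    exact LinearMap.congr_fun this a
  have hX : ∀ a, L (ι X * a) = T * L a := fun a => by rw [hι, aeval_X]
  have hx₁ : ∀ a, L (x₁ * a) = Y₁ * L a := by
    intro a
    have : L ∘ₗ LinearMap.mulLeft 𝕜 x₁ = LinearMap.mulLeft 𝕜 Y₁ ∘ₗ L := by
      refine hA.linearMap_ext fun n i j => ?_
      simp only [LinearMap.comp_apply, LinearMap.mulLeft_apply]
      induction n with
      | zero => simp only [pow_zero, one_mul, ← mul_assoc, ← pow_succ', hmon]
      | succ n ih =>
        rw [pow_succ', mul_assoc, hA.rel_smul₁, map_add, map_add, map_smul, map_smul, hX, hι, hX,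
          ih, ← mul_assoc Y₁, h₁]
        simp only [add_mul, smul_mul_assoc, mul_assoc]
    exact LinearMap.congr_fun this a
  have hx₂ : ∀ a, L (x₂ * a) = Y₂ * L a := by
    intro a
    have : L ∘ₗ LinearMap.mulLeft 𝕜 x₂ = LinearMap.mulLeft 𝕜 Y₂ ∘ₗ L := by
      refine hA.linearMap_ext fun n i j => ?_
      simp only [LinearMap.comp_apply, LinearMap.mulLeft_apply]
      induction n with
      | zero =>
        simp only [pow_zero, one_mul]
        induction i with
        | zero =>
          have := hmon 0 (j + 1)
          have h0 := hmon 0 j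
          simp only [pow_zero, one_mul] at this h0 ⊢
          rw [← pow_succ', this, h0, pow_succ']
        | succ i ih =>
          rw [pow_succ', mul_assoc, hA.rel_smul₁₂, map_add, map_add, map_add, map_smul, map_smul,
            map_smul, map_smul, hx₁, hx₁, ih, ← mul_assoc Y₂, h₁₂, Algebra.smul_def P.q₀]
          simp only [add_mul, smul_mul_assoc, mul_assoc]
      | succ n ih =>
        rw [pow_succ', mul_assoc, hA.rel_smul₂, map_add, map_add, map_smul, map_smul, hX, hι, hX,
          ih, ← mul_assoc Y₂, h₂]
        simp only [add_mul, smul_mul_assoc, mul_assoc]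
    exact LinearMap.congr_fun this a
  have hx₁pow : ∀ i a, L (x₁ ^ i * a) = Y₁ ^ i * L a := by
    intro i a
    induction i with
    | zero => simp
    | succ i ih => rw [pow_succ', mul_assoc, hx₁, ih, pow_succ', mul_assoc]
  have hx₂pow : ∀ i a, L (x₂ ^ i * a) = Y₂ ^ i * L a := by
    intro i a
    induction i with
    | zero => simp
    | succ i ih => rw [pow_succ', mul_assoc, hx₂, ih, pow_succ', mul_assoc]
  have hone : L 1 = 1 := by simpa using hmon 0 0
  have hmul : ∀ a b, L (a * b) = L a * L b := by
    intro a b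
    have : L ∘ₗ LinearMap.mulRight 𝕜 b = LinearMap.mulRight 𝕜 (L b) ∘ₗ L := by
      refine hA.linearMap_ext fun n i j => ?_
      simp only [LinearMap.comp_apply, LinearMap.mulRight_apply]
      rw [hpow, ← map_pow, mul_assoc, mul_assoc, hι, hx₁pow, hx₂pow, map_pow, aeval_X]
      simp only [mul_assoc]
    exact LinearMap.congr_fun this a
  refine ⟨AlgHom.ofLinearMap L hone hmul, ?_, ?_, ?_⟩
  · simpa [hone] using hX 1
  · simpa [hone] using hx₁ 1
  · simpa [hone] using hx₂ 1

theorem adjoin_eq_top (hA : P.IsExtension ι x₁ x₂) :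
    Algebra.adjoin 𝕜 ({ι X, x₁, x₂} : Set A) = ⊤ := by
  have h : (Algebra.adjoin 𝕜 ({ι X, x₁, x₂} : Set A)).toSubmodule = ⊤ := by
    rw [← Submodule.ker_mkQ (Algebra.adjoin 𝕜 ({ι X, x₁, x₂} : Set A)).toSubmodule,
      LinearMap.ker_eq_top]
    refine hA.linearMap_ext fun n i j => ?_
    rw [LinearMap.zero_apply, ← LinearMap.mem_ker, Submodule.ker_mkQ, Subalgebra.mem_toSubmodule]
    have hm : ∀ a ∈ ({ι X, x₁, x₂} : Set A), a ∈ Algebra.adjoin 𝕜 ({ι X, x₁, x₂} : Set A) :=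
      fun a ha => Algebra.subset_adjoin ha
    exact mul_mem (pow_mem (hm _ (by simp)) _)
      (mul_mem (pow_mem (hm _ (by simp)) _) (pow_mem (hm _ (by simp)) _))
  rwa [← Algebra.toSubmodule_eq_top]

theorem finiteType (hA : P.IsExtension ι x₁ x₂) : Algebra.FiniteType 𝕜 A :=
  ⟨Subalgebra.fg_def.2 ⟨_, by simp, hA.adjoin_eq_top⟩⟩

theorem algHom_ext (hA : P.IsExtension ι x₁ x₂) {B : Type*} [Ring B] [Algebra 𝕜 B]
    {φ ψ : A →ₐ[𝕜] B} (hX : φ (ι X) = ψ (ι X)) (h₁ : φ x₁ = ψ x₁) (h₂ : φ x₂ = ψ x₂) : φ = ψ := by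
  refine AlgHom.ext_of_adjoin_eq_top hA.adjoin_eq_top ?_
  rintro a (rfl | rfl | rfl) <;> assumption

theorem algHom_apply (φ : A →ₐ[𝕜] A) (f : 𝕜[X]) : φ (ι f) = aeval (φ (ι X)) f := by
  have : φ.comp ι = aeval (φ (ι X)) := by ext; simp
  exact AlgHom.congr_fun this f

theorem algEquiv_apply (φ : A ≃ₐ[𝕜] A) (f : 𝕜[X]) : φ (ι f) = aeval (φ (ι X)) f :=
  algHom_apply (φ : A →ₐ[𝕜] A) f

/-- Induction on words in the generators. -/
theorem induction (hA : P.IsExtension ι x₁ x₂) {p : A → Prop} (hX : p (ι X)) (h₁ : p x₁)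
    (h₂ : p x₂) (halg : ∀ r, p (algebraMap 𝕜 A r)) (hadd : ∀ a b, p a → p b → p (a + b))
    (hmul : ∀ a b, p a → p b → p (a * b)) (a : A) : p a := by
  have ha : a ∈ Algebra.adjoin 𝕜 ({ι X, x₁, x₂} : Set A) := hA.adjoin_eq_top ▸ Algebra.mem_top
  induction ha using Algebra.adjoin_induction with
  | mem a ha => rcases ha with rfl | rfl | rfl <;> assumption
  | algebraMap r => exact halg r
  | add a b _ _ ha hb => exact hadd a b ha hb
  | mul a b _ _ ha hb => exact hmul a b ha hb

end SkewPBWData.IsExtension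

/-! ### Gelfand–Kirillov dimension -/

section Limits

open Filter Topology

theorem limsup_le_three {r : ℕ → ℕ} {M : ℕ} (hM : 0 < M)
    (h : ∀ n, r n ≤ (M * n + 1) ^ 3) :
    limsup (fun n : ℕ => ((Real.log (r n) / Real.log n : ℝ) : EReal)) atTop ≤ 3 := by
  have hlim : Tendsto (fun n : ℕ => 3 * Real.log (M + 1) / Real.log n + 3) atTop (𝓝 (0 + 3)) :=
    ((Real.tendsto_log_atTop.comp tendsto_natCast_atTop_atTop).const_div_atTop _).add_const 3
  rw [zero_add] at hlim
  have hlim' := (continuous_coe_real_ereal.tendsto 3).comp hlim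
  have h3 : ((3 : ℝ) : EReal) = 3 := rfl
  rw [← h3, ← hlim'.limsup_eq]
  refine limsup_le_limsup ?_
  filter_upwards [eventually_ge_atTop 2] with n hn
  rw [Function.comp_apply, EReal.coe_le_coe_iff]
  have hlog : 0 < Real.log n := Real.log_pos (by exact_mod_cast hn)
  have hn0 : (0 : ℝ) < n := by exact_mod_cast (by omega : 0 < n)
  rw [div_add' _ _ _ hlog.ne', div_le_div_iff_of_pos_right hlog]
  rcases Nat.eq_zero_or_pos (r n) with h0 | h0
  · rw [h0, Nat.cast_zero, Real.log_zero]
    have : 0 ≤ Real.log ((M : ℝ) + 1) := Real.log_nonneg (by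
      have : (0 : ℝ) ≤ M := Nat.cast_nonneg M
      linarith)
    positivity
  · have hle : (r n : ℝ) ≤ (((M : ℝ) + 1) * n) ^ 3 := by
      have h1 : r n ≤ ((M + 1) * n) ^ 3 := (h n).trans (Nat.pow_le_pow_left (by nlinarith) 3)
      exact_mod_cast h1
    calc Real.log (r n) ≤ Real.log ((((M : ℝ) + 1) * n) ^ 3) :=
          Real.log_le_log (by exact_mod_cast h0) hle
      _ = 3 * Real.log (M + 1) + 3 * Real.log n := by
          rw [Real.log_pow, Real.log_mul (by positivity) hn0.ne']
          push_cast
          ring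

theorem three_le_limsup {r : ℕ → ℕ} (h : ∀ n, (n / 3 + 1) ^ 3 ≤ r n) :
    3 ≤ limsup (fun n : ℕ => ((Real.log (r n) / Real.log n : ℝ) : EReal)) atTop := by
  have hlim : Tendsto (fun n : ℕ => (-(3 * Real.log 3)) / Real.log n + 3) atTop (𝓝 (0 + 3)) :=
    ((Real.tendsto_log_atTop.comp tendsto_natCast_atTop_atTop).const_div_atTop _).add_const 3
  rw [zero_add] at hlim
  have hlim' := (continuous_coe_real_ereal.tendsto 3).comp hlim
  have h3 : ((3 : ℝ) : EReal) = 3 := rfl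
  rw [← h3, ← hlim'.limsup_eq]
  refine limsup_le_limsup ?_
  filter_upwards [eventually_ge_atTop 2] with n hn
  rw [Function.comp_apply, EReal.coe_le_coe_iff]
  have hlog : 0 < Real.log n := Real.log_pos (by exact_mod_cast hn)
  have hn0 : (0 : ℝ) < n := by exact_mod_cast (by omega : 0 < n)
  rw [div_add' _ _ _ hlog.ne', div_le_div_iff_of_pos_right hlog]
  have hle : ((n : ℝ) / 3) ^ 3 ≤ r n := by
    have h1 : (((n / 3 + 1 : ℕ) : ℝ)) ^ 3 ≤ r n := by exact_mod_cast h n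
    refine le_trans (pow_le_pow_left₀ (by positivity) ?_ 3) h1
    rw [div_le_iff₀ (by norm_num)]
    have : n ≤ (n / 3 + 1) * 3 := by omega
    exact_mod_cast this
  calc -(3 * Real.log 3) + 3 * Real.log n = Real.log (((n : ℝ) / 3) ^ 3) := by
        rw [Real.log_pow, Real.log_div hn0.ne' (by norm_num)]
        push_cast
        ring
    _ ≤ Real.log (r n) := Real.log_le_log (by positivity) hle

end Limits

namespace SkewPBWData.IsExtension

variable {𝕜 : Type u} {A : Type v} [Field 𝕜] [Ring A] [Algebra 𝕜 A] {P : SkewPBWData 𝕜}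
  {ι : 𝕜[X] →ₐ[𝕜] A} {x₁ x₂ : A}

/-- The span of the monomials of weight at most `m`, where `t` has weight `1` and `x₁, x₂` have weight
`N`. Once `N` bounds the degrees of `p₁` and `p₂`, the relations do not raise the weight. -/
def weightFiltration (ι : 𝕜[X] →ₐ[𝕜] A) (x₁ x₂ : A) (N m : ℕ) : Submodule 𝕜 A :=
  Submodule.span 𝕜 {a | ∃ n i j, n + N * i + N * j ≤ m ∧ ι X ^ n * (x₁ ^ i * x₂ ^ j) = a}

theorem monomial_mem {N n i j m : ℕ} (h : n + N * i + N * j ≤ m) :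
    ι X ^ n * (x₁ ^ i * x₂ ^ j) ∈ weightFiltration ι x₁ x₂ N m :=
  Submodule.subset_span ⟨n, i, j, h, rfl⟩

theorem weightFiltration_mono {N : ℕ} : Monotone (weightFiltration ι x₁ x₂ N) := by
  intro m m' h
  refine Submodule.span_mono ?_
  rintro _ ⟨n, i, j, hle, rfl⟩
  exact ⟨n, i, j, hle.trans h, rfl⟩

theorem mul_mem_of_monomial {N w : ℕ} {g : A}
    (hg : ∀ n i j, g * (ι X ^ n * (x₁ ^ i * x₂ ^ j)) ∈
      weightFiltration ι x₁ x₂ N (n + N * i + N * j + w)) {m : ℕ} {a : A}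
    (ha : a ∈ weightFiltration ι x₁ x₂ N m) : g * a ∈ weightFiltration ι x₁ x₂ N (m + w) := by
  induction ha using Submodule.span_induction with
  | mem a h =>
    obtain ⟨n, i, j, hle, rfl⟩ := h
    exact weightFiltration_mono (by omega) (hg n i j)
  | zero => rw [mul_zero]; exact zero_mem _
  | add a b _ _ ha hb => rw [mul_add]; exact add_mem ha hb
  | smul r a _ ha => rw [mul_smul_comm]; exact Submodule.smul_mem _ r ha

theorem X_mul_mem {N m : ℕ} {a : A} (ha : a ∈ weightFiltration ι x₁ x₂ N m) :
    ι X * a ∈ weightFiltration ι x₁ x₂ N (m + 1) := by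
  refine mul_mem_of_monomial (fun n i j => ?_) ha
  rw [← mul_assoc, ← pow_succ']
  exact monomial_mem (by omega)

theorem X_pow_mul_mem {N m : ℕ} {a : A} (ha : a ∈ weightFiltration ι x₁ x₂ N m) (n : ℕ) :
    ι X ^ n * a ∈ weightFiltration ι x₁ x₂ N (m + n) := by
  induction n with
  | zero => simpa using ha
  | succ n ih =>
    rw [pow_succ', mul_assoc, ← add_assoc]
    exact X_mul_mem ih

theorem coeff_mul_mem {N m : ℕ} {f : 𝕜[X]} (hf : f.natDegree ≤ N) {a : A}
    (ha : a ∈ weightFiltration ι x₁ x₂ N m) : ι f * a ∈ weightFiltration ι x₁ x₂ N (m + N) := by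
  rw [f.as_sum_range_C_mul_X_pow, map_sum, Finset.sum_mul]
  refine sum_mem fun k hk => ?_
  rw [← smul_eq_C_mul, map_smul, smul_mul_assoc, map_pow]
  refine Submodule.smul_mem _ _ (weightFiltration_mono ?_ (X_pow_mul_mem ha k))
  have := Finset.mem_range.1 hk
  omega

theorem x₁_mul_mem (hA : P.IsExtension ι x₁ x₂) {N : ℕ} (hp : P.p₁.natDegree ≤ N) {m : ℕ} {a : A}
    (ha : a ∈ weightFiltration ι x₁ x₂ N m) : x₁ * a ∈ weightFiltration ι x₁ x₂ N (m + N) := by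
  refine mul_mem_of_monomial (fun n i j => ?_) ha
  induction n with
  | zero =>
    have h : x₁ * (ι X ^ 0 * (x₁ ^ i * x₂ ^ j)) = ι X ^ 0 * (x₁ ^ (i + 1) * x₂ ^ j) := by
      simp only [pow_zero, one_mul, ← mul_assoc, ← pow_succ']
    rw [h]
    exact monomial_mem (by rw [mul_add, mul_one]; omega)
  | succ n ih =>
    rw [pow_succ', mul_assoc, hA.rel_smul₁]
    refine add_mem (add_mem (Submodule.smul_mem _ _ ?_) (Submodule.smul_mem _ _ ?_)) ?_
    · exact weightFiltration_mono (by omega) (X_mul_mem ih)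
    · exact weightFiltration_mono (by omega) ih
    · exact weightFiltration_mono (by omega) (coeff_mul_mem hp (monomial_mem le_rfl))

theorem x₂_mul_mem (hA : P.IsExtension ι x₁ x₂) {N : ℕ} (hp₁ : P.p₁.natDegree ≤ N)
    (hp₂ : P.p₂.natDegree ≤ N) {m : ℕ} {a : A}
    (ha : a ∈ weightFiltration ι x₁ x₂ N m) : x₂ * a ∈ weightFiltration ι x₁ x₂ N (m + N) := by
  refine mul_mem_of_monomial (fun n i j => ?_) ha
  induction n with
  | zero =>
    have h0 : ∀ i j, x₁ ^ i * x₂ ^ j ∈ weightFiltration ι x₁ x₂ N (N * i + N * j) := fun i j => by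
      have := monomial_mem (ι := ι) (x₁ := x₁) (x₂ := x₂) (N := N) (n := 0) (i := i) (j := j) le_rfl
      simpa using this
    simp only [pow_zero, one_mul, zero_add]
    induction i with
    | zero =>
      have := h0 0 (j + 1)
      simp only [pow_zero, one_mul] at this ⊢
      rw [← pow_succ']
      exact weightFiltration_mono (by rw [mul_add, mul_one]; omega) this
    | succ i ih =>
      rw [pow_succ', mul_assoc, hA.rel_smul₁₂]
      refine add_mem (add_mem (add_mem (Submodule.smul_mem _ _ ?_) (Submodule.smul_mem _ _ ?_))
        (Submodule.smul_mem _ _ ?_)) (Submodule.smul_mem _ _ ?_)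
      · exact weightFiltration_mono (by rw [mul_add, mul_one]; omega) (hA.x₁_mul_mem hp₁ ih)
      · exact weightFiltration_mono (by rw [mul_add, mul_one]; omega) (h0 i j)
      · exact weightFiltration_mono (by rw [mul_add, mul_one]; omega)
          (hA.x₁_mul_mem hp₁ (h0 i j))
      · exact weightFiltration_mono (by rw [mul_add, mul_one]; omega) ih
  | succ n ih =>
    rw [pow_succ', mul_assoc, hA.rel_smul₂]
    refine add_mem (add_mem (Submodule.smul_mem _ _ ?_) (Submodule.smul_mem _ _ ?_)) ?_
    · exact weightFiltration_mono (by omega) (X_mul_mem ih)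
    · exact weightFiltration_mono (by omega) ih
    · exact weightFiltration_mono (by omega) (coeff_mul_mem hp₂ (monomial_mem le_rfl))

theorem weightFiltration_mul_le (hA : P.IsExtension ι x₁ x₂) {N : ℕ} (hp₁ : P.p₁.natDegree ≤ N)
    (hp₂ : P.p₂.natDegree ≤ N) (k m : ℕ) :
    weightFiltration ι x₁ x₂ N k * weightFiltration ι x₁ x₂ N m ≤
      weightFiltration ι x₁ x₂ N (k + m) := by
  have h₁ : ∀ i {m a}, a ∈ weightFiltration ι x₁ x₂ N m →
      x₁ ^ i * a ∈ weightFiltration ι x₁ x₂ N (m + N * i) := by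
    intro i m a ha
    induction i with
    | zero => simpa using ha
    | succ i ih =>
      rw [pow_succ', mul_assoc, mul_add, mul_one, ← add_assoc]
      exact hA.x₁_mul_mem hp₁ ih
  have h₂ : ∀ i {m a}, a ∈ weightFiltration ι x₁ x₂ N m →
      x₂ ^ i * a ∈ weightFiltration ι x₁ x₂ N (m + N * i) := by
    intro i m a ha
    induction i with
    | zero => simpa using ha
    | succ i ih =>
      rw [pow_succ', mul_assoc, mul_add, mul_one, ← add_assoc]
      exact hA.x₂_mul_mem hp₁ hp₂ ih
  rw [Submodule.mul_le]
  intro a ha b hb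
  induction ha using Submodule.span_induction with
  | mem a h =>
    obtain ⟨n, i, j, hle, rfl⟩ := h
    rw [mul_assoc, mul_assoc]
    exact weightFiltration_mono (by omega) (X_pow_mul_mem (h₁ i (h₂ j hb)) n)
  | zero => rw [zero_mul]; exact zero_mem _
  | add a b _ _ ha hb => rw [add_mul]; exact add_mem ha hb
  | smul r a _ ha => rw [smul_mul_assoc]; exact Submodule.smul_mem _ r ha

theorem one_mem_weightFiltration {N m : ℕ} : (1 : A) ∈ weightFiltration ι x₁ x₂ N m := by
  have := monomial_mem (ι := ι) (x₁ := x₁) (x₂ := x₂) (N := N) (n := 0) (i := 0) (j := 0) (m := m)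
    (by simp)
  simpa using this

theorem exists_mem_weightFiltration (hA : P.IsExtension ι x₁ x₂) {N : ℕ}
    (hp₁ : P.p₁.natDegree ≤ N) (hp₂ : P.p₂.natDegree ≤ N) (a : A) :
    ∃ m, a ∈ weightFiltration ι x₁ x₂ N m := by
  have one_mem : (1 : A) ∈ weightFiltration ι x₁ x₂ N 0 := one_mem_weightFiltration
  induction a using hA.induction with
  | hX => exact ⟨_, by simpa using X_mul_mem one_mem⟩
  | h₁ => exact ⟨_, by simpa using hA.x₁_mul_mem hp₁ one_mem⟩
  | h₂ => exact ⟨_, by simpa using hA.x₂_mul_mem hp₁ hp₂ one_mem⟩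
  | halg r =>
    rw [Algebra.algebraMap_eq_smul_one]
    exact ⟨0, Submodule.smul_mem _ _ one_mem⟩
  | hadd a b ha hb =>
    obtain ⟨m, hm⟩ := ha
    obtain ⟨k, hk⟩ := hb
    exact ⟨max m k, add_mem (weightFiltration_mono (le_max_left _ _) hm)
      (weightFiltration_mono (le_max_right _ _) hk)⟩
  | hmul a b ha hb =>
    obtain ⟨m, hm⟩ := ha
    obtain ⟨k, hk⟩ := hb
    exact ⟨m + k, hA.weightFiltration_mul_le hp₁ hp₂ m k (Submodule.mul_mem_mul hm hk)⟩

theorem finrank_le_of_le_weightFiltration {N m : ℕ} (hN : 0 < N) {V : Submodule 𝕜 A}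
    (hV : V ≤ weightFiltration ι x₁ x₂ N m) : Module.finrank 𝕜 V ≤ (m + 1) ^ 3 := by
  classical
  let s : Finset A := (Finset.range (m + 1) ×ˢ Finset.range (m + 1) ×ˢ Finset.range (m + 1)).image
    fun p => ι X ^ p.1 * (x₁ ^ p.2.1 * x₂ ^ p.2.2)
  have hs : V ≤ Submodule.span 𝕜 (s : Set A) := by
    refine hV.trans (Submodule.span_mono ?_)
    rintro _ ⟨n, i, j, hle, rfl⟩
    have hi : i ≤ N * i := Nat.le_mul_of_pos_left i hN
    have hj : j ≤ N * j := Nat.le_mul_of_pos_left j hN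
    refine Finset.mem_coe.2 (Finset.mem_image.2 ⟨(n, i, j), ?_, rfl⟩)
    simp only [Finset.mem_product, Finset.mem_range]
    omega
  calc Module.finrank 𝕜 V ≤ Module.finrank 𝕜 (Submodule.span 𝕜 (s : Set A)) :=
        Submodule.finrank_mono hs
    _ ≤ s.card := finrank_span_finset_le_card s
    _ ≤ _ := Finset.card_image_le
    _ = (m + 1) ^ 3 := by
      simp only [Finset.card_product, Finset.card_range]
      ring

theorem linearIndependent_monomials (hA : P.IsExtension ι x₁ x₂) :
    LinearIndependent 𝕜 fun p : ℕ × ℕ × ℕ => ι X ^ p.1 * (x₁ ^ p.2.1 * x₂ ^ p.2.2) := by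
  have h := ((Finsupp.basis fun _ : ℕ × ℕ => Polynomial.basisMonomials 𝕜).map
    hA.coordEquiv).linearIndependent.comp (fun p : ℕ × ℕ × ℕ => (⟨p.2, p.1⟩ : Σ _ : ℕ × ℕ, ℕ))
      (fun p q hpq => by
        simp only [Sigma.mk.injEq, heq_eq_eq] at hpq
        exact Prod.ext hpq.2 hpq.1)
  convert h using 1
  funext ⟨n, i, j⟩
  simp [coordEquiv_single, ← X_pow_eq_monomial]

theorem gkDim_eq_three (hA : P.IsExtension ι x₁ x₂) : gkDim 𝕜 A = 3 := by
  classical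
  apply le_antisymm
  · refine iSup_le fun V => iSup_le fun hV => iSup_le fun _ => ?_
    obtain ⟨N, hN, hp₁, hp₂⟩ : ∃ N, 0 < N ∧ P.p₁.natDegree ≤ N ∧ P.p₂.natDegree ≤ N :=
      ⟨P.p₁.natDegree + P.p₂.natDegree + 1, by omega, by omega, by omega⟩
    obtain ⟨M, hM, hVM⟩ : ∃ M, 0 < M ∧ V ≤ weightFiltration ι x₁ x₂ N M := by
      obtain ⟨s, rfl⟩ := hV
      choose w hw using hA.exists_mem_weightFiltration hp₁ hp₂
      refine ⟨s.sup w + 1, by omega, Submodule.span_le.2 fun a ha => ?_⟩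
      exact weightFiltration_mono ((Finset.le_sup (f := w) ha).trans (Nat.le_succ _)) (hw a)
    refine limsup_le_three hM fun n => finrank_le_of_le_weightFiltration (ι := ι) (x₁ := x₁)
      (x₂ := x₂) hN ?_
    induction n with
    | zero =>
      rw [pow_zero, Submodule.one_le]
      exact one_mem_weightFiltration
    | succ n ih =>
      rw [pow_succ, mul_add, mul_one]
      exact (mul_le_mul' ih hVM).trans (hA.weightFiltration_mul_le hp₁ hp₂ _ _)
  · let V : Submodule 𝕜 A := Submodule.span 𝕜 (({1, ι X, x₁, x₂} : Finset A) : Set A)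
    have hV : V.FG := ⟨_, rfl⟩
    have hmem : ∀ a ∈ ({1, ι X, x₁, x₂} : Finset A), a ∈ V := fun a ha => Submodule.subset_span ha
    have h1 : (1 : A) ∈ V := hmem _ (by simp)
    refine le_trans ?_ (le_iSup_of_le V (le_iSup_of_le hV (le_iSup_of_le h1 le_rfl)))
    refine three_le_limsup fun n => ?_
    have hmono : ∀ n i j k, n + i + j ≤ k → ι X ^ n * (x₁ ^ i * x₂ ^ j) ∈ V ^ k := by
      intro n i j k hk
      refine pow_le_pow_right₀ (Submodule.one_le.2 h1) hk ?_
      rw [add_assoc, pow_add, pow_add]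
      exact Submodule.mul_mem_mul (Submodule.pow_mem_pow _ (hmem _ (by simp)) n)
        (Submodule.mul_mem_mul (Submodule.pow_mem_pow _ (hmem _ (by simp)) i)
          (Submodule.pow_mem_pow _ (hmem _ (by simp)) j))
    let g : Fin (n / 3 + 1) × Fin (n / 3 + 1) × Fin (n / 3 + 1) → (V ^ n : Submodule 𝕜 A) := fun p =>
      ⟨ι X ^ (p.1 : ℕ) * (x₁ ^ (p.2.1 : ℕ) * x₂ ^ (p.2.2 : ℕ)), hmono _ _ _ _ (by omega)⟩
    have hg : LinearIndependent 𝕜 g := by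
      refine LinearIndependent.of_comp (V ^ n : Submodule 𝕜 A).subtype ?_
      exact hA.linearIndependent_monomials.comp
        (fun p : Fin (n / 3 + 1) × Fin (n / 3 + 1) × Fin (n / 3 + 1) =>
          ((p.1 : ℕ), (p.2.1 : ℕ), (p.2.2 : ℕ)))
        (fun p q hpq => by
          simp only [Prod.mk.injEq, Fin.val_inj] at hpq
          exact Prod.ext hpq.1 (Prod.ext hpq.2.1 hpq.2.2))
    have : Module.Finite 𝕜 (V ^ n : Submodule 𝕜 A) := Module.Finite.of_fg (hV.pow n)
    have := hg.fintype_card_le_finrank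
    refine le_trans (le_of_eq ?_) this
    simp only [Fintype.card_prod, Fintype.card_fin]
    ring

end SkewPBWData.IsExtension

/-! ### Automorphisms and skew derivations of a skew PBW extension -/

namespace SkewPBWData.IsExtension

variable {𝕜 : Type u} {A : Type v} [Field 𝕜] [Ring A] [Algebra 𝕜 A] {P : SkewPBWData 𝕜}
  {ι : 𝕜[X] →ₐ[𝕜] A} {x₁ x₂ : A}

theorem x₁_mul_X (hA : P.IsExtension ι x₁ x₂) :
    x₁ * ι X = P.a₁ • (ι X * x₁) + P.b₁ • x₁ + ι P.p₁ := by
  simpa using hA.rel_smul₁ 1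

theorem x₂_mul_X (hA : P.IsExtension ι x₁ x₂) :
    x₂ * ι X = P.a₂ • (ι X * x₂) + P.b₂ • x₂ + ι P.p₂ := by
  simpa using hA.rel_smul₂ 1

theorem aeval_affine (r s : 𝕜) (f : 𝕜[X]) :
    aeval (r • ι X + algebraMap 𝕜 A s) f = ι (f.comp (C r * X + C s)) := by
  have h : r • ι X + algebraMap 𝕜 A s = ι (C r * X + C s) := by
    rw [map_add, ← smul_eq_C_mul, map_smul, ← Polynomial.algebraMap_eq, AlgHom.commutes]
  rw [h, aeval_algHom_apply, ← Polynomial.comp_eq_aeval]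

theorem exists_affine_algHom (hA : P.IsExtension ι x₁ x₂) (hq₁ : P.q₁ = 0) (hq₂ : P.q₂ = 0)
    {r s u v : 𝕜} (hb₁ : r * P.b₁ + s = P.a₁ * s + P.b₁) (hb₂ : r * P.b₂ + s = P.a₂ * s + P.b₂)
    (hp₁ : P.p₁.comp (C r * X + C s) = (u * r) • P.p₁)
    (hp₂ : P.p₂.comp (C r * X + C s) = (v * r) • P.p₂) (hq₀ : u * v * P.q₀ = P.q₀) :
    ∃ φ : A →ₐ[𝕜] A, φ (ι X) = r • ι X + algebraMap 𝕜 A s ∧ φ x₁ = u • x₁ ∧ φ x₂ = v • x₂ := by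
  refine hA.exists_algHom _ _ _ ?_ ?_ ?_
  · rw [aeval_affine, hp₁, map_smul, Algebra.algebraMap_eq_smul_one]
    simp only [mul_add, add_mul, smul_mul_assoc, mul_smul_comm, mul_one, one_mul, hA.x₁_mul_X]
    linear_combination (norm := module) (u * hb₁) • x₁
  · rw [aeval_affine, hp₂, map_smul, Algebra.algebraMap_eq_smul_one]
    simp only [mul_add, add_mul, smul_mul_assoc, mul_smul_comm, mul_one, one_mul, hA.x₂_mul_X]
    linear_combination (norm := module) (v * hb₂) • x₂
  · rw [hq₁, hq₂, Algebra.algebraMap_eq_smul_one]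
    simp only [smul_mul_assoc, mul_smul_comm, hA.rel₁₂, hq₁, hq₂, Algebra.algebraMap_eq_smul_one]
    linear_combination (norm := module) hq₀ • (1 : A)

/-- The conditions are inherited by the inverse substitution, so that the endomorphism of
`exists_affine_algHom` is invertible; the equivalence given here is its inverse. -/
theorem exists_affine_algEquiv (hA : P.IsExtension ι x₁ x₂) (hq₁ : P.q₁ = 0) (hq₂ : P.q₂ = 0)
    {r s u v : 𝕜} (hr : r ≠ 0) (hu : u ≠ 0) (hv : v ≠ 0)
    (hb₁ : r * P.b₁ + s = P.a₁ * s + P.b₁) (hb₂ : r * P.b₂ + s = P.a₂ * s + P.b₂)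
    (hp₁ : P.p₁.comp (C r * X + C s) = (u * r) • P.p₁)
    (hp₂ : P.p₂.comp (C r * X + C s) = (v * r) • P.p₂) (hq₀ : u * v * P.q₀ = P.q₀) :
    ∃ φ : A ≃ₐ[𝕜] A, φ (ι X) = r⁻¹ • ι X - algebraMap 𝕜 A (r⁻¹ * s) ∧ φ x₁ = u⁻¹ • x₁ ∧
      φ x₂ = v⁻¹ • x₂ := by
  have hinv : ∀ (p : 𝕜[X]) (w : 𝕜), w ≠ 0 → p.comp (C r * X + C s) = (w * r) • p →
      p.comp (C r⁻¹ * X + C (-(r⁻¹ * s))) = (w⁻¹ * r⁻¹) • p := by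
    intro p w hw h
    have h' := congrArg (fun f => (w⁻¹ * r⁻¹) • f.comp (C r⁻¹ * X + C (-(r⁻¹ * s)))) h
    simp only [comp_assoc, smul_comp, smul_smul] at h'
    have h1 : w⁻¹ * r⁻¹ * (w * r) = 1 := by field_simp
    have h2 : (C r * X + C s).comp (C r⁻¹ * X + C (-(r⁻¹ * s))) = X := by
      simp only [add_comp, mul_comp, C_comp, X_comp, mul_add, ← mul_assoc, ← C_mul]
      rw [mul_inv_cancel₀ hr, mul_neg, mul_inv_cancel_left₀ hr]
      simp
    rw [h1, one_smul, h2, comp_X] at h'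
    exact h'.symm
  obtain ⟨φ, hφX, hφ₁, hφ₂⟩ := hA.exists_affine_algHom hq₁ hq₂ hb₁ hb₂ hp₁ hp₂ hq₀
  obtain ⟨ψ, hψX, hψ₁, hψ₂⟩ := hA.exists_affine_algHom hq₁ hq₂ (r := r⁻¹) (s := -(r⁻¹ * s))
    (u := u⁻¹) (v := v⁻¹)
    (by field_simp; linear_combination -hb₁) (by field_simp; linear_combination -hb₂)
    (hinv _ _ hu hp₁) (hinv _ _ hv hp₂) (by field_simp; linear_combination -hq₀)
  refine ⟨AlgEquiv.ofAlgHom ψ φ ?_ ?_, ?_, hψ₁, hψ₂⟩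
  · refine hA.algHom_ext ?_ ?_ ?_
    · simp only [AlgHom.comp_apply, AlgHom.id_apply, hφX, map_add, map_smul, hψX, map_one,
        smul_add, smul_smul, mul_inv_cancel₀ hr, one_smul, Algebra.algebraMap_eq_smul_one]
      rw [mul_neg, mul_inv_cancel_left₀ hr]
      module
    · simp [hφ₁, hψ₁, smul_smul, hu]
    · simp [hφ₂, hψ₂, smul_smul, hv]
  · refine hA.algHom_ext ?_ ?_ ?_
    · simp only [AlgHom.comp_apply, AlgHom.id_apply, hφX, map_add, map_smul, hψX, map_one,
        smul_add, smul_smul, inv_mul_cancel₀ hr, one_smul, Algebra.algebraMap_eq_smul_one]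
      module
    · simp [hφ₁, hψ₁, smul_smul, hu]
    · simp [hφ₂, hψ₂, smul_smul, hv]
  · change ψ (ι X) = _
    rw [hψX, map_neg, sub_eq_add_neg]

/-- Here `w` is the common value of the commutators `δ₂(g₁)` and `c δ₁(g₂)`. -/
theorem exists_translation_algHom (hA : P.IsExtension ι x₁ x₂) (hq₁ : P.q₁ = 0) (hq₂ : P.q₂ = 0)
    {u v : 𝕜} {g₁ g₂ : 𝕜[X]} {w : A}
    (hp₁ : (u - 1) • P.p₁ = (C (P.a₁ - 1) * X + C P.b₁) * g₁)
    (hp₂ : (v - 1) • P.p₂ = (C (P.a₂ - 1) * X + C P.b₂) * g₂)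
    (hq₀ : u * v * P.q₀ = P.q₀) (hg₁ : x₂ * ι g₁ = P.c • (ι g₁ * x₂) + w)
    (hg₂ : P.c • (x₁ * ι g₂) = ι g₂ * x₁ + w) (hw : u • w = v • w)
    (hg : P.c • (g₁ * g₂) = g₁ * g₂) :
    ∃ φ : A →ₐ[𝕜] A, φ (ι X) = ι X ∧ φ x₁ = u • x₁ + ι g₁ ∧ φ x₂ = v • x₂ + ι g₂ := by
  have haev : ∀ f, aeval (ι X) f = ι f := fun f => by rw [aeval_algHom_apply, aeval_X_left_apply]
  have hcomm : ∀ f, ι f * ι X = ι X * ι f := fun f => by rw [← map_mul, mul_comm, map_mul]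
  have key : ∀ (a b r : 𝕜) (p g : 𝕜[X]), (r - 1) • p = (C (a - 1) * X + C b) * g →
      (r - 1) • ι p = (a - 1) • (ι X * ι g) + b • ι g := by
    intro a b r p g h
    have := congrArg ι h
    rwa [add_mul, mul_assoc, ← smul_eq_C_mul, ← smul_eq_C_mul, map_add, map_smul, map_smul,
      map_smul, map_mul] at this
  have k₁ := key _ _ _ _ _ hp₁
  have k₂ := key _ _ _ _ _ hp₂
  have k := congrArg ι hg
  rw [map_smul, map_mul] at k
  have hc : ι g₂ * ι g₁ = ι g₁ * ι g₂ := by rw [← map_mul, mul_comm, map_mul]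
  refine hA.exists_algHom _ _ _ ?_ ?_ ?_
  · rw [haev]
    simp only [mul_add, add_mul, smul_mul_assoc, mul_smul_comm, hA.x₁_mul_X, hcomm]
    linear_combination (norm := module) k₁
  · rw [haev]
    simp only [mul_add, add_mul, smul_mul_assoc, mul_smul_comm, hA.x₂_mul_X, hcomm]
    linear_combination (norm := module) k₂
  · rw [hq₁, hq₂]
    simp only [mul_add, add_mul, smul_mul_assoc, mul_smul_comm, hA.rel₁₂, hq₁, hq₂, hg₁, hc,
      Algebra.algebraMap_eq_smul_one]
    linear_combination (norm := module) hq₀ • (1 : A) - k - u • hg₂ - hw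

theorem exists_translation_algEquiv (hA : P.IsExtension ι x₁ x₂) (hq₁ : P.q₁ = 0) (hq₂ : P.q₂ = 0)
    {u v : 𝕜} {g₁ g₂ : 𝕜[X]} {w : A} (hu : u ≠ 0) (hv : v ≠ 0)
    (hp₁ : (u - 1) • P.p₁ = (C (P.a₁ - 1) * X + C P.b₁) * g₁)
    (hp₂ : (v - 1) • P.p₂ = (C (P.a₂ - 1) * X + C P.b₂) * g₂)
    (hq₀ : u * v * P.q₀ = P.q₀) (hg₁ : x₂ * ι g₁ = P.c • (ι g₁ * x₂) + w)
    (hg₂ : P.c • (x₁ * ι g₂) = ι g₂ * x₁ + w) (hw : u • w = v • w)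
    (hg : P.c • (g₁ * g₂) = g₁ * g₂) :
    ∃ φ : A ≃ₐ[𝕜] A, φ (ι X) = ι X ∧ φ x₁ = u • x₁ + ι g₁ ∧ φ x₂ = v • x₂ + ι g₂ := by
  obtain ⟨φ, hφX, hφ₁, hφ₂⟩ := hA.exists_translation_algHom hq₁ hq₂ hp₁ hp₂ hq₀ hg₁ hg₂ hw hg
  -- the inverse is again of this form, with `gᵢ` divided by `-u`, `-v` and `w` by `-u`
  have hpinv : ∀ (r : 𝕜) (p g l : 𝕜[X]), r ≠ 0 → (r - 1) • p = l * g →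
      (r⁻¹ - 1) • p = l * (-r⁻¹ • g) := by
    intro r p g l hr h
    rw [mul_smul_comm, ← h, smul_smul]
    congr 1
    field_simp
    ring
  have hw' : u⁻¹ • w = v⁻¹ • w := by
    have := congrArg (fun z => (u⁻¹ * v⁻¹) • z) hw
    simp only [smul_smul] at this
    rw [mul_right_comm, inv_mul_cancel₀ hu, one_mul, mul_assoc, inv_mul_cancel₀ hv, mul_one] at this
    exact this.symm
  obtain ⟨ψ, hψX, hψ₁, hψ₂⟩ := hA.exists_translation_algHom hq₁ hq₂ (u := u⁻¹) (v := v⁻¹)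
    (g₁ := -u⁻¹ • g₁) (g₂ := -v⁻¹ • g₂) (w := -u⁻¹ • w)
    (hpinv _ _ _ _ hu hp₁) (hpinv _ _ _ _ hv hp₂) (by field_simp; linear_combination -hq₀)
    (by rw [map_smul, mul_smul_comm, hg₁, smul_mul_assoc]; module)
    (by
      rw [map_smul, mul_smul_comm, smul_comm, hg₂, smul_mul_assoc, smul_add, neg_smul _ w,
        neg_smul _ w, hw'])
    (by rw [smul_comm, hw', smul_comm])
    (by simp only [smul_mul_smul_comm]; rw [smul_comm, hg])
  have hι : ∀ (θ : A →ₐ[𝕜] A), θ (ι X) = ι X → ∀ f, θ (ι f) = ι f := by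
    intro θ hθ f
    rw [algHom_apply, hθ, aeval_algHom_apply, aeval_X_left_apply]
  refine ⟨AlgEquiv.ofAlgHom φ ψ ?_ ?_, hφX, hφ₁, hφ₂⟩
  · refine hA.algHom_ext (by simp [hφX, hψX]) ?_ ?_
    · simp [hφ₁, hψ₁, hι φ hφX, smul_smul, hu]
    · simp [hφ₂, hψ₂, hι φ hφX, smul_smul, hv]
  · refine hA.algHom_ext (by simp [hφX, hψX]) ?_ ?_
    · simp [hφ₁, hψ₁, hι ψ hψX, smul_smul, hu]
    · simp [hφ₂, hψ₂, hι ψ hψX, smul_smul, hv]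

/-- A `ν`-skew derivation `D` is the same as an algebra map `a ↦ !![ν a, D a; 0, a]` into matrices, hence
exists as soon as its values on the generators satisfy the differentiated relations. The map `E` is the
restriction of `D` to `𝕜[t]`. -/
theorem exists_skewDerivation (hA : P.IsExtension ι x₁ x₂) (ν : A ≃ₐ[𝕜] A) (E : 𝕜[X] →ₗ[𝕜] A)
    (hE1 : E 1 = 0) (hE : ∀ f, E (X * f) = E X * ι f + ν (ι X) * E f) (y₁ y₂ : A)
    (h₁ : ν x₁ * E X + y₁ * ι X =
      P.a₁ • (ν (ι X) * y₁ + E X * x₁) + P.b₁ • y₁ + E P.p₁)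
    (h₂ : ν x₂ * E X + y₂ * ι X =
      P.a₂ • (ν (ι X) * y₂ + E X * x₂) + P.b₂ • y₂ + E P.p₂)
    (h₁₂ : ν x₂ * y₁ + y₂ * x₁ =
      P.c • (ν x₁ * y₂ + y₁ * x₂) + P.q₁ • y₁ + P.q₂ • y₂) :
    ∃ D : A →ₗ[𝕜] A, (∀ a b, D (a * b) = D a * b + ν a * D b) ∧ (∀ f, D (ι f) = E f) ∧
      D x₁ = y₁ ∧ D x₂ = y₂ := by
  have hT : ∀ f : 𝕜[X], aeval (!![ν (ι X), E X; 0, ι X] : Matrix (Fin 2) (Fin 2) A) f =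
      !![ν (ι f), E f; 0, ι f] := by
    intro f
    induction f using Polynomial.induction_on with
    | C r =>
      rw [aeval_C, ← Polynomial.algebraMap_eq, Algebra.algebraMap_eq_smul_one (A := 𝕜[X]), map_smul,
        map_smul, map_smul, map_one, hE1, map_one, Algebra.algebraMap_eq_smul_one]
      ext i j
      fin_cases i <;> fin_cases j <;> simp
    | add f g hf hg =>
      rw [map_add, hf, hg]
      ext i j
      fin_cases i <;> fin_cases j <;> simp
    | monomial n r h =>
      have e : C r * X ^ (n + 1) = X * (C r * X ^ n) := by ring
      rw [e, map_mul, h, aeval_X, hE]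
      ext i j
      fin_cases i <;> fin_cases j <;> simp [Matrix.mul_apply, add_comm]
  obtain ⟨F, hFX, hF₁, hF₂⟩ := hA.exists_algHom
    (!![ν (ι X), E X; 0, ι X] : Matrix (Fin 2) (Fin 2) A) !![ν x₁, y₁; 0, x₁] !![ν x₂, y₂; 0, x₂]
    (by
      rw [hT]
      have e := congrArg ν hA.x₁_mul_X
      simp only [map_mul, map_add, map_smul] at e
      ext i j
      fin_cases i <;> fin_cases j <;>
        simp [Matrix.mul_apply, hA.x₁_mul_X, e]
      rw [h₁, smul_add])
    (by
      rw [hT]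
      have e := congrArg ν hA.x₂_mul_X
      simp only [map_mul, map_add, map_smul] at e
      ext i j
      fin_cases i <;> fin_cases j <;>
        simp [Matrix.mul_apply, hA.x₂_mul_X, e]
      rw [h₂, smul_add])
    (by
      have e := congrArg ν hA.rel₁₂
      simp only [map_mul, map_add, map_smul] at e
      rw [AlgEquiv.commutes] at e
      ext i j
      fin_cases i <;> fin_cases j <;>
        simp [Matrix.mul_apply, hA.rel₁₂, e, Matrix.algebraMap_matrix_apply]
      rw [h₁₂, smul_add])
  have hF : ∀ a, F a 0 0 = ν a ∧ F a 1 0 = 0 ∧ F a 1 1 = a := by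
    intro a
    induction a using hA.induction with
    | hX => simp [hFX]
    | h₁ => simp [hF₁]
    | h₂ => simp [hF₂]
    | halg r => simp [Matrix.algebraMap_matrix_apply]
    | hadd a b ha hb => simp [ha, hb]
    | hmul a b ha hb => simp [Matrix.mul_apply, ha, hb]
  refine ⟨{ toFun := fun a => F a 0 1, map_add' := fun a b => by simp,
            map_smul' := fun r a => by simp }, fun a b => ?_, fun f => ?_, ?_, ?_⟩
  · change F (a * b) 0 1 = F a 0 1 * b + ν a * F b 0 1
    rw [map_mul, Matrix.mul_apply, Fin.sum_univ_two, (hF a).1, (hF b).2.2, add_comm]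
  · change F (ι f) 0 1 = E f
    have : F (ι f) = aeval (F (ι X)) f := by
      rw [aeval_algHom_apply, aeval_algHom_apply, aeval_X_left_apply]
    rw [this, hFX, hT]
    rfl
  · change F x₁ 0 1 = y₁
    rw [hF₁]
    rfl
  · change F x₂ 0 1 = y₂
    rw [hF₂]
    rfl

/-- A map with a twisted Leibniz rule is determined by its values on the generators. -/
theorem eq_zero_of_leibniz (hA : P.IsExtension ι x₁ x₂) (E : A →ₗ[𝕜] A) (μ ρ : A ≃ₐ[𝕜] A)
    (hE : ∀ a b, E (a * b) = E a * ρ b + μ a * E b) (hX : E (ι X) = 0) (h₁ : E x₁ = 0)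
    (h₂ : E x₂ = 0) (a : A) : E a = 0 := by
  have h1 : E 1 = 0 := by simpa using hE 1 1
  induction a using hA.induction with
  | hX => exact hX
  | h₁ => exact h₁
  | h₂ => exact h₂
  | halg r => rw [Algebra.algebraMap_eq_smul_one, map_smul, h1, smul_zero]
  | hadd a b ha hb => rw [map_add, ha, hb, add_zero]
  | hmul a b ha hb => rw [hE, ha, hb, zero_mul, mul_zero, add_zero]

theorem skewDerivation_comp_eq (hA : P.IsExtension ι x₁ x₂) {D : A →ₗ[𝕜] A} {ν μ : A ≃ₐ[𝕜] A}
    (hD : ∀ a b, D (a * b) = D a * b + ν a * D b) (hcomm : ∀ a, ν (μ a) = μ (ν a)) {r s : 𝕜}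
    (hX : r • D (μ (ι X)) = s • μ (D (ι X))) (h₁ : r • D (μ x₁) = s • μ (D x₁))
    (h₂ : r • D (μ x₂) = s • μ (D x₂)) (a : A) : r • D (μ a) = s • μ (D a) := by
  have := hA.eq_zero_of_leibniz (r • (D ∘ₗ μ.toLinearMap) - s • (μ.toLinearMap ∘ₗ D))
    (μ.trans ν) μ
    (fun a b => by
      simp only [LinearMap.sub_apply, LinearMap.smul_apply, LinearMap.comp_apply,
        AlgEquiv.toLinearMap_apply, map_mul, hD, map_add, AlgEquiv.trans_apply,
        hcomm, sub_mul, mul_sub, smul_mul_assoc, mul_smul_comm, smul_add]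
      abel)
    (by simpa [sub_eq_zero] using hX) (by simpa [sub_eq_zero] using h₁)
    (by simpa [sub_eq_zero] using h₂) a
  simpa [sub_eq_zero] using this

theorem skewDerivation_comm (hA : P.IsExtension ι x₁ x₂) {D E : A →ₗ[𝕜] A} {ν μ : A ≃ₐ[𝕜] A}
    (hD : ∀ a b, D (a * b) = D a * b + ν a * D b) (hE : ∀ a b, E (a * b) = E a * b + μ a * E b)
    (hcomm : ∀ a, ν (μ a) = μ (ν a)) {s : 𝕜} (hDμ : ∀ a, D (μ a) = s • μ (D a))
    (hEν : ∀ a, ν (E a) = s • E (ν a))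
    (hX : D (E (ι X)) = s • E (D (ι X))) (h₁ : D (E x₁) = s • E (D x₁))
    (h₂ : D (E x₂) = s • E (D x₂)) (a : A) : D (E a) = s • E (D a) := by
  have := hA.eq_zero_of_leibniz (D ∘ₗ E - s • (E ∘ₗ D))
    (μ.trans ν) AlgEquiv.refl
    (fun a b => by
      simp only [LinearMap.sub_apply, LinearMap.smul_apply, LinearMap.comp_apply, hD, hE, map_add,
        AlgEquiv.trans_apply, AlgEquiv.coe_refl, id_eq, hcomm, hDμ, hEν, sub_mul, mul_sub,
        smul_mul_assoc, mul_smul_comm, smul_add]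
      abel)
    (by simpa [sub_eq_zero] using hX) (by simpa [sub_eq_zero] using h₁)
    (by simpa [sub_eq_zero] using h₂) a
  simpa [sub_eq_zero] using this

end SkewPBWData.IsExtension

/-! ### The frame of a skew PBW extension -/

namespace SkewPBWData

variable {𝕜 : Type u} [Field 𝕜]

/-- The conditions on the parameters under which the calculus exists. With `σᵢ(t) = aᵢ t + bᵢ`: `σ₁` and
`σ₂` commute (`shift`), every `pᵢ` is an eigenvector of every `σⱼ`, the derivative of `pᵢ` interacts with
`σᵢ` as for a polynomial of degree at most one centred at the fixed point of `σᵢ` (`euler₁`, `euler₂`),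
and either both `pᵢ` have degree at most one or nothing is twisted and the vector fields `pᵢ d/dt`
commute. -/
structure Compatible (P : SkewPBWData 𝕜) : Prop where
  q₁ : P.q₁ = 0
  q₂ : P.q₂ = 0
  c_mul_q₀ : P.c * P.q₀ = P.q₀
  a₁_mul_a₂_mul_q₀ : P.a₁ * P.a₂ * P.q₀ = P.q₀
  shift : P.a₁ * P.b₂ + P.b₁ = P.a₂ * P.b₁ + P.b₂
  p₁_comp₁ : P.p₁.comp (C P.a₁ * X + C P.b₁) = P.a₁ • P.p₁
  p₂_comp₁ : P.p₂.comp (C P.a₁ * X + C P.b₁) = (P.c⁻¹ * P.a₁) • P.p₂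
  p₁_comp₂ : P.p₁.comp (C P.a₂ * X + C P.b₂) = (P.c * P.a₂) • P.p₁
  p₂_comp₂ : P.p₂.comp (C P.a₂ * X + C P.b₂) = P.a₂ • P.p₂
  euler₁ : (P.a₁ - 1) • P.p₁ = (C (P.a₁ - 1) * X + C P.b₁) * derivative P.p₁
  euler₂ : (P.a₂ - 1) • P.p₂ = (C (P.a₂ - 1) * X + C P.b₂) * derivative P.p₂
  constant_or_untwisted :
    (∃ k₁ k₂ : 𝕜, derivative P.p₁ = C k₁ ∧ derivative P.p₂ = C k₂) ∨
    (P.a₁ = 1 ∧ P.b₁ = 0 ∧ P.a₂ = 1 ∧ P.b₂ = 0 ∧ P.c = 1 ∧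
      P.p₂ * derivative P.p₁ = P.p₁ * derivative P.p₂)

theorem derivative_comp_affine {p : 𝕜[X]} {a b s : 𝕜} (ha : a ≠ 0)
    (h : p.comp (C a * X + C b) = (s * a) • p) :
    (derivative p).comp (C a * X + C b) = s • derivative p := by
  have h' := congrArg derivative h
  rw [derivative_comp, derivative_smul] at h'
  have e : derivative (C a * X + C b) = C a := by simp
  rw [e, ← smul_eq_C_mul, mul_comm s a, mul_smul] at h'
  exact smul_right_injective 𝕜[X] ha h'

end SkewPBWData

namespace SkewPBWData.IsExtension

variable {𝕜 : Type u} {A : Type v} [Field 𝕜] [Ring A] [Algebra 𝕜 A] {P : SkewPBWData 𝕜}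
  {ι : 𝕜[X] →ₐ[𝕜] A} {x₁ x₂ : A}

/-- If `[x, t] = p(t)`, then `[x, ·]` is the derivation `p d/dt` of `𝕜[t]`. -/
theorem mul_coeff_of_commutator {x : A} {p : 𝕜[X]} (h : x * ι X = ι X * x + ι p) (f : 𝕜[X]) :
    x * ι f = ι f * x + ι (p * derivative f) := by
  induction f using Polynomial.induction_on with
  | C r =>
    rw [derivative_C, mul_zero, map_zero, add_zero, ← Polynomial.algebraMap_eq, AlgHom.commutes]
    exact (Algebra.commutes r x).symm
  | add f g hf hg => rw [map_add, mul_add, hf, hg, derivative_add, mul_add, map_add]; noncomm_ring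
  | monomial n r hf =>
    have e : C r * X ^ (n + 1) = X * (C r * X ^ n) := by ring
    have e' : p * derivative (X * (C r * X ^ n)) =
        X * (p * derivative (C r * X ^ n)) + p * (C r * X ^ n) := by
      rw [derivative_mul (f := X), derivative_X]
      ring
    rw [e, e', map_mul, ← mul_assoc, h, add_mul, mul_assoc, hf, map_add, map_mul ι X, map_mul ι p (C r * X ^ n)]
    noncomm_ring

/-- The automorphism by which functions are moved past `dt`. -/
theorem exists_translation (hA : P.IsExtension ι x₁ x₂) (hP : P.Compatible) :
    ∃ ν : A ≃ₐ[𝕜] A, ν (ι X) = ι X ∧ ν x₁ = P.a₁ • x₁ + ι (derivative P.p₁) ∧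
      ν x₂ = P.a₂ • x₂ + ι (derivative P.p₂) := by
  rcases hP.constant_or_untwisted with ⟨k₁, k₂, h₁, h₂⟩ | ⟨ha₁, hb₁, ha₂, hb₂, hc, hp⟩
  · have hk₁ : P.c • ι (C k₁) = ι (C k₁) := by
      have := derivative_comp_affine P.a₂_ne hP.p₁_comp₂
      rw [h₁, C_comp] at this
      rw [← map_smul, ← this]
    have hk₂ : P.c • ι (C k₂) = ι (C k₂) := by
      have := derivative_comp_affine P.a₁_ne hP.p₂_comp₁
      rw [h₂, C_comp] at this
      rw [← map_smul]
      nth_rewrite 1 [this]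
      rw [smul_smul, mul_inv_cancel₀ P.c_ne, one_smul]
    have hcomm : ∀ k x, ι (C k) * x = x * ι (C k) := fun k x => by
      rw [← Polynomial.algebraMap_eq, AlgHom.commutes]
      exact Algebra.commutes k x
    refine hA.exists_translation_algEquiv hP.q₁ hP.q₂ (w := 0) P.a₁_ne P.a₂_ne hP.euler₁ hP.euler₂
      hP.a₁_mul_a₂_mul_q₀ ?_ ?_ (by simp) ?_
    · rw [h₁, add_zero, ← smul_mul_assoc, hk₁, hcomm]
    · rw [h₂, add_zero, ← mul_smul_comm, hk₂, hcomm]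
    · rw [h₁, h₂, ← smul_mul_assoc]
      have := derivative_comp_affine P.a₂_ne hP.p₁_comp₂
      rw [h₁, C_comp] at this
      rw [← this]
  · have hp' : P.p₂ * derivative (derivative P.p₁) = P.p₁ * derivative (derivative P.p₂) := by
      have := congrArg derivative hp
      rw [derivative_mul, derivative_mul, mul_comm (derivative P.p₂)] at this
      exact add_left_cancel this
    refine hA.exists_translation_algEquiv hP.q₁ hP.q₂
      (w := ι (P.p₂ * derivative (derivative P.p₁))) P.a₁_ne P.a₂_ne hP.euler₁ hP.euler₂
      hP.a₁_mul_a₂_mul_q₀ ?_ ?_ (by rw [ha₁, ha₂]) (by rw [hc, one_smul])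
    · rw [hc, one_smul]
      refine mul_coeff_of_commutator ?_ _
      rw [hA.x₂_mul_X, ha₂, hb₂, one_smul, zero_smul, add_zero]
    · rw [hc, one_smul, hp']
      refine mul_coeff_of_commutator ?_ _
      rw [hA.x₁_mul_X, ha₁, hb₁, one_smul, zero_smul, add_zero]

/-- The frame of `A` dual to `dt, dx₁, dx₂`. Differentiating the defining relations dictates the
automorphisms: `ν₁` fixes `t` and sends `xᵢ` to `aᵢ xᵢ + pᵢ'`; `ν₂` is `σ₁⁻¹` on `t` and sends `x₂` to
`c x₂`; `ν₃` is `σ₂⁻¹` on `t` and sends `x₁` to `c⁻¹ x₁`. -/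
theorem exists_frame (hA : P.IsExtension ι x₁ x₂) (hP : P.Compatible) :
    ∃ S : SkewFrame 𝕜 A, (∀ f, S.D₁ (ι f) = ι (derivative f)) ∧
      (∀ f, S.D₂ (ι f) = 0) ∧ (S.D₂ x₁ = 1 ∧ S.D₂ x₂ = 0) ∧
      (∀ f, S.D₃ (ι f) = 0) ∧ (S.D₃ x₁ = 0 ∧ S.D₃ x₂ = 1) ∧
      (∃ σ : 𝕜[X] →ₐ[𝕜] 𝕜[X], ∀ f, S.ν₂ (ι f) = ι (σ f)) ∧ S.ν₂ x₁ = x₁ ∧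
      (∃ σ : 𝕜[X] →ₐ[𝕜] 𝕜[X], ∀ f, S.ν₃ (ι f) = ι (σ f)) ∧ S.ν₃ x₁ = P.c⁻¹ • x₁ ∧ S.ν₃ x₂ = x₂ := by
  obtain ⟨ν₁, h₁X, h₁₁, h₁₂⟩ := hA.exists_translation hP
  obtain ⟨ν₂, h₂X, h₂₁, h₂₂⟩ := hA.exists_affine_algEquiv hP.q₁ hP.q₂ (r := P.a₁) (s := P.b₁)
    (u := 1) (v := P.c⁻¹) P.a₁_ne one_ne_zero (inv_ne_zero P.c_ne) rfl hP.shift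
    (by rw [one_mul]; exact hP.p₁_comp₁) hP.p₂_comp₁
    (by rw [one_mul, inv_mul_eq_iff_eq_mul₀ P.c_ne]; exact hP.c_mul_q₀.symm)
  obtain ⟨ν₃, h₃X, h₃₁, h₃₂⟩ := hA.exists_affine_algEquiv hP.q₁ hP.q₂ (r := P.a₂) (s := P.b₂)
    (u := P.c) (v := 1) P.a₂_ne P.c_ne one_ne_zero hP.shift.symm rfl hP.p₁_comp₂
    (by rw [one_mul]; exact hP.p₂_comp₂) (by rw [mul_one]; exact hP.c_mul_q₀)
  rw [inv_one, one_smul] at h₂₁ h₃₂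
  rw [inv_inv] at h₂₂
  have ha₁ := P.a₁_ne
  have ha₂ := P.a₂_ne
  have hc := P.c_ne
  -- the inverse of an affine substitution
  have hinv : ∀ (ν : A ≃ₐ[𝕜] A) (a b : 𝕜), a ≠ 0 →
      ν (ι X) = a⁻¹ • ι X - algebraMap 𝕜 A (a⁻¹ * b) →
      ∀ f, ν (ι (f.comp (C a * X + C b))) = ι f := by
    intro ν a b ha h f
    have e := algEquiv_apply (ι := ι) ν (f.comp (C a * X + C b))
    rw [h, aeval_comp] at e
    rw [e]
    have : aeval (a⁻¹ • ι X - algebraMap 𝕜 A (a⁻¹ * b)) (C a * X + C b) = ι X := by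
      rw [map_add, map_mul, aeval_X, aeval_C, aeval_C, ← Algebra.smul_def, smul_sub, smul_smul,
        mul_inv_cancel₀ ha, one_smul, Algebra.smul_def, ← map_mul, mul_inv_cancel_left₀ ha,
        sub_add_cancel]
    rw [this, aeval_algHom_apply, aeval_X_left_apply]
  have hsurj : ∀ (ν : A ≃ₐ[𝕜] A) (a b : 𝕜),
      ν (ι X) = a⁻¹ • ι X - algebraMap 𝕜 A (a⁻¹ * b) → ∃ σ : 𝕜[X] →ₐ[𝕜] 𝕜[X], ∀ f, ν (ι f) = ι (σ f) := by
    intro ν a b h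
    refine ⟨aeval (C a⁻¹ * X + C (-(a⁻¹ * b))), fun f => ?_⟩
    have e := algEquiv_apply (ι := ι) ν f
    rw [h, sub_eq_add_neg, ← map_neg, aeval_affine] at e
    rw [e, comp_eq_aeval]
  have h₂p₁ : ν₂ (ι (derivative P.p₁)) = ι (derivative P.p₁) := by
    have e := derivative_comp_affine (s := 1) ha₁ (by rw [one_mul]; exact hP.p₁_comp₁)
    have := hinv ν₂ _ _ ha₁ h₂X (derivative P.p₁)
    rwa [e, one_smul] at this
  have h₂p₂ : ν₂ (ι (derivative P.p₂)) = P.c • ι (derivative P.p₂) := by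
    have := hinv ν₂ _ _ ha₁ h₂X (derivative P.p₂)
    rw [derivative_comp_affine ha₁ hP.p₂_comp₁, map_smul, map_smul] at this
    exact (inv_smul_eq_iff₀ hc).1 this
  have h₃p₁ : ν₃ (ι (derivative P.p₁)) = P.c⁻¹ • ι (derivative P.p₁) := by
    have := hinv ν₃ _ _ ha₂ h₃X (derivative P.p₁)
    rw [derivative_comp_affine ha₂ hP.p₁_comp₂, map_smul, map_smul] at this
    rw [eq_inv_smul_iff₀ hc, this]
  have h₃p₂ : ν₃ (ι (derivative P.p₂)) = ι (derivative P.p₂) := by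
    have e := derivative_comp_affine (s := 1) ha₂ (by rw [one_mul]; exact hP.p₂_comp₂)
    have := hinv ν₃ _ _ ha₂ h₃X (derivative P.p₂)
    rwa [e, one_smul] at this
  obtain ⟨D₁, hD₁, hD₁ι, hD₁x₁, hD₁x₂⟩ := hA.exists_skewDerivation ν₁
    (ι.toLinearMap ∘ₗ derivative) (by simp)
    (fun f => by simp [h₁X]) 0 0 (by simp [h₁₁]) (by simp [h₁₂]) (by simp)
  obtain ⟨D₂, hD₂, hD₂ι, hD₂x₁, hD₂x₂⟩ := hA.exists_skewDerivation ν₂ 0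
    (by simp) (fun f => by simp) 1 0
    (by simp [h₂X, smul_sub, smul_smul, ha₁, Algebra.algebraMap_eq_smul_one])
    (by simp) (by simp [h₂₂, hP.q₁])
  obtain ⟨D₃, hD₃, hD₃ι, hD₃x₁, hD₃x₂⟩ := hA.exists_skewDerivation ν₃ 0
    (by simp) (fun f => by simp) 0 1 (by simp)
    (by simp [h₃X, smul_sub, smul_smul, ha₂, Algebra.algebraMap_eq_smul_one])
    (by simp [h₃₁, hP.q₂, smul_smul, hc])
  simp only [LinearMap.zero_apply] at hD₂ι hD₃ι
  have hD₁ι' : ∀ f, D₁ (ι f) = ι (derivative f) := hD₁ι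
  have hone : ∀ (D : A →ₗ[𝕜] A) (ν : A ≃ₐ[𝕜] A), (∀ a b, D (a * b) = D a * b + ν a * D b) →
      ∀ r, D (algebraMap 𝕜 A r) = 0 := by
    intro D ν h r
    have : D 1 = 0 := by simpa using h 1 1
    rw [Algebra.algebraMap_eq_smul_one, map_smul, this, smul_zero]
  have hD₁r := hone D₁ ν₁ hD₁
  have hD₂r := hone D₂ ν₂ hD₂
  have hD₃r := hone D₃ ν₃ hD₃
  have ext : ∀ μ ν : A ≃ₐ[𝕜] A, μ (ν (ι X)) = ν (μ (ι X)) → μ (ν x₁) = ν (μ x₁) →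
      μ (ν x₂) = ν (μ x₂) → ∀ a, μ (ν a) = ν (μ a) := by
    intro μ ν hX h₁ h₂ a
    have := hA.algHom_ext (φ := ((ν.trans μ : A ≃ₐ[𝕜] A) : A →ₐ[𝕜] A))
      (ψ := ((μ.trans ν : A ≃ₐ[𝕜] A) : A →ₐ[𝕜] A)) hX h₁ h₂
    exact AlgHom.congr_fun this a
  have hν₂₁ : ∀ a, ν₂ (ν₁ a) = ν₁ (ν₂ a) := by
    refine ext _ _ ?_ ?_ ?_
    · simp [h₁X, h₂X]
    · simp [h₁₁, h₂₁, h₂p₁]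
    · simp [h₁₂, h₂₂, h₂p₂, smul_smul, mul_comm]
  have hν₃₁ : ∀ a, ν₃ (ν₁ a) = ν₁ (ν₃ a) := by
    refine ext _ _ ?_ ?_ ?_
    · simp [h₁X, h₃X]
    · simp [h₁₁, h₃₁, h₃p₁, smul_smul, mul_comm]
    · simp [h₁₂, h₃₂, h₃p₂]
  have hν₃₂ : ∀ a, ν₃ (ν₂ a) = ν₂ (ν₃ a) := by
    refine ext _ _ ?_ ?_ ?_
    · simp only [h₂X, h₃X, map_sub, map_smul, Algebra.algebraMap_eq_smul_one, map_one]
      have := hP.shift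
      have h' : P.a₁⁻¹ * (P.a₂⁻¹ * P.b₂) + P.a₁⁻¹ * P.b₁ =
          P.a₂⁻¹ * (P.a₁⁻¹ * P.b₁) + P.a₂⁻¹ * P.b₂ := by
        field_simp
        linear_combination -this
      linear_combination (norm := module) -h' • (1 : A)
    · simp [h₂₁, h₃₁]
    · simp [h₂₂, h₃₂]
  have hD₂ν₁ : ∀ a, D₂ (ν₁ a) = P.a₁ • ν₁ (D₂ a) := fun a => by
    have := hA.skewDerivation_comp_eq hD₂ hν₂₁ (r := 1) (s := P.a₁)
      (by simp [h₁X, hD₂ι]) (by simp [h₁₁, hD₂ι, hD₂x₁]) (by simp [h₁₂, hD₂ι, hD₂x₂]) a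
    rwa [one_smul] at this
  have hD₃ν₁ : ∀ a, D₃ (ν₁ a) = P.a₂ • ν₁ (D₃ a) := fun a => by
    have := hA.skewDerivation_comp_eq hD₃ hν₃₁ (r := 1) (s := P.a₂)
      (by simp [h₁X, hD₃ι]) (by simp [h₁₁, hD₃ι, hD₃x₁]) (by simp [h₁₂, hD₃ι, hD₃x₂]) a
    rwa [one_smul] at this
  have hD₃ν₂ : ∀ a, D₃ (ν₂ a) = P.c • ν₂ (D₃ a) := fun a => by
    have := hA.skewDerivation_comp_eq hD₃ hν₃₂ (r := 1) (s := P.c)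
      (by simp [h₂X, hD₃ι, hD₃r, -map_mul]) (by simp [h₂₁, hD₃x₁]) (by simp [h₂₂, hD₃x₂]) a
    rwa [one_smul] at this
  have hν₂D₁ : ∀ a, ν₂ (D₁ a) = P.a₁ • D₁ (ν₂ a) := fun a => by
    have := hA.skewDerivation_comp_eq hD₁ (fun a => (hν₂₁ a).symm) (r := P.a₁) (s := 1)
      (by simp [h₂X, hD₁ι', hD₁r, -map_mul, smul_smul, ha₁]) (by simp [h₂₁, hD₁x₁])
      (by simp [h₂₂, hD₁x₂]) a
    rw [one_smul] at this
    exact this.symm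
  have hν₃D₁ : ∀ a, ν₃ (D₁ a) = P.a₂ • D₁ (ν₃ a) := fun a => by
    have := hA.skewDerivation_comp_eq hD₁ (fun a => (hν₃₁ a).symm) (r := P.a₂) (s := 1)
      (by simp [h₃X, hD₁ι', hD₁r, -map_mul, smul_smul, ha₂]) (by simp [h₃₁, hD₁x₁])
      (by simp [h₃₂, hD₁x₂]) a
    rw [one_smul] at this
    exact this.symm
  have hν₃D₂ : ∀ a, ν₃ (D₂ a) = P.c • D₂ (ν₃ a) := fun a => by
    have := hA.skewDerivation_comp_eq hD₂ (fun a => (hν₃₂ a).symm) (r := P.c) (s := 1)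
      (by simp [h₃X, hD₂ι, hD₂r, -map_mul]) (by simp [h₃₁, hD₂x₁, smul_smul, hc])
      (by simp [h₃₂, hD₂x₂]) a
    rw [one_smul] at this
    exact this.symm
  have h1 : ∀ (D : A →ₗ[𝕜] A), (∀ r, D (algebraMap 𝕜 A r) = 0) → D 1 = 0 := fun D h => by
    simpa using h 1
  have hD₁1 := h1 D₁ hD₁r
  have hD₂1 := h1 D₂ hD₂r
  have hD₃1 := h1 D₃ hD₃r
  let S : SkewFrame 𝕜 A :=
    { ν₁ := ν₁
      ν₂ := ν₂
      ν₃ := ν₃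
      D₁ := D₁
      D₂ := D₂
      D₃ := D₃
      α := P.a₁
      β := P.a₂
      γ := P.c
      α_ne := ha₁
      β_ne := ha₂
      γ_ne := hc
      leibniz₁ := hD₁
      leibniz₂ := hD₂
      leibniz₃ := hD₃
      ν₂ν₁ := hν₂₁
      ν₃ν₁ := hν₃₁
      ν₃ν₂ := hν₃₂
      D₂ν₁ := hD₂ν₁
      D₃ν₁ := hD₃ν₁
      D₃ν₂ := hD₃ν₂
      ν₂D₁ := hν₂D₁
      ν₃D₁ := hν₃D₁
      ν₃D₂ := hν₃D₂
      D₂D₁ := hA.skewDerivation_comm hD₂ hD₁ hν₂₁ hD₂ν₁ hν₂D₁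
        (by simp [hD₁ι', hD₂ι, hD₂1]) (by simp [hD₁x₁, hD₂x₁, hD₁1]) (by simp [hD₁x₂, hD₂x₂])
      D₃D₁ := hA.skewDerivation_comm hD₃ hD₁ hν₃₁ hD₃ν₁ hν₃D₁
        (by simp [hD₁ι', hD₃ι, hD₃1]) (by simp [hD₁x₁, hD₃x₁]) (by simp [hD₁x₂, hD₃x₂, hD₁1])
      D₃D₂ := hA.skewDerivation_comm hD₃ hD₂ hν₃₂ hD₃ν₂ hν₃D₂
        (by simp [hD₂ι, hD₃ι]) (by simp [hD₂x₁, hD₃x₁, hD₃1]) (by simp [hD₂x₂, hD₃x₂, hD₂1])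
      u₁ := ι X
      u₂ := x₁
      u₃ := x₂
      D₁u₁ := by simp [hD₁ι']
      D₂u₁ := hD₂ι X
      D₃u₁ := hD₃ι X
      D₁u₂ := hD₁x₁
      D₂u₂ := hD₂x₁
      D₃u₂ := hD₃x₁
      D₁u₃ := hD₁x₂
      D₂u₃ := hD₂x₂
      D₃u₃ := hD₃x₂ }
  exact ⟨S, hD₁ι', hD₂ι, ⟨hD₂x₁, hD₂x₂⟩, hD₃ι, ⟨hD₃x₁, hD₃x₂⟩,
    hsurj ν₂ _ _ h₂X, h₂₁, hsurj ν₃ _ _ h₃X, h₃₁, h₃₂⟩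

end SkewPBWData.IsExtension

/-! ### Coordinates and connectedness -/

section SkewLeibniz

variable {𝕜 : Type u} {A : Type v} [Field 𝕜] [Ring A] [Algebra 𝕜 A]

theorem skewDerivation_pow_eq_zero {D : A →ₗ[𝕜] A} {ν : A ≃ₐ[𝕜] A}
    (hD : ∀ a b, D (a * b) = D a * b + ν a * D b) {y : A} (h : D y = 0) (n : ℕ) :
    D (y ^ n) = 0 := by
  induction n with
  | zero => simpa using hD 1 1
  | succ n ih => rw [pow_succ, hD, ih, h, zero_mul, mul_zero, add_zero]

theorem skewDerivation_pow_succ {D : A →ₗ[𝕜] A} {ν : A ≃ₐ[𝕜] A}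
    (hD : ∀ a b, D (a * b) = D a * b + ν a * D b) {y : A} (hν : ν y = y) (h : D y = 1) (n : ℕ) :
    D (y ^ (n + 1)) = ((n : 𝕜) + 1) • y ^ n := by
  induction n with
  | zero => simp [h]
  | succ n ih =>
    rw [pow_succ, hD, ih, h, map_pow, hν, smul_mul_assoc, ← pow_succ, mul_one, Nat.cast_succ]
    module

end SkewLeibniz

namespace SkewPBWData.IsExtension

variable {𝕜 : Type u} {A : Type v} [Field 𝕜] [Ring A] [Algebra 𝕜 A] {P : SkewPBWData 𝕜}
  {ι : 𝕜[X] →ₐ[𝕜] A} {x₁ x₂ : A}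

/-- The coefficient in `𝕜[t]` of `x₁ⁱ x₂ʲ`. -/
def coord (hA : P.IsExtension ι x₁ x₂) (i j : ℕ) : A →ₗ[𝕜] 𝕜[X] :=
  Finsupp.lapply (i, j) ∘ₗ hA.coordEquiv.symm.toLinearMap

theorem coord_monomial (hA : P.IsExtension ι x₁ x₂) (i j k l : ℕ) (f : 𝕜[X]) :
    hA.coord i j (ι f * (x₁ ^ k * x₂ ^ l)) = if k = i ∧ l = j then f else 0 := by
  rw [coord, LinearMap.comp_apply, LinearEquiv.coe_coe, coordEquiv_symm_apply,
    Finsupp.lapply_apply, Finsupp.single_apply]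
  simp only [Prod.mk.injEq]

theorem eq_of_coord (hA : P.IsExtension ι x₁ x₂) {a : A}
    (h : ∀ i j, (i, j) ≠ (0, 0) → hA.coord i j a = 0) : a = ι (hA.coord 0 0 a) := by
  have h' : hA.coordEquiv.symm a = Finsupp.single (0, 0) (hA.coord 0 0 a) := by
    ext1 ⟨i, j⟩
    by_cases hij : (i, j) = (0, 0)
    · rw [hij, Finsupp.single_eq_same]
      rfl
    · rw [Finsupp.single_eq_of_ne hij]
      exact h i j hij
  have := congrArg hA.coordEquiv h'
  rwa [LinearEquiv.apply_symm_apply, coordEquiv_single, pow_zero, pow_zero, mul_one, mul_one] at this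

/-- On coordinates `∂/∂x₁` acts, up to the injective map `σ`, as the usual partial derivative. -/
theorem coord_skewDerivation₁ (hA : P.IsExtension ι x₁ x₂) {D : A →ₗ[𝕜] A} {ν : A ≃ₐ[𝕜] A}
    (hD : ∀ a b, D (a * b) = D a * b + ν a * D b) {σ : 𝕜[X] →ₐ[𝕜] 𝕜[X]}
    (hσ : ∀ f, ν (ι f) = ι (σ f)) (hν : ν x₁ = x₁) (hι : ∀ f, D (ι f) = 0) (h₁ : D x₁ = 1)
    (h₂ : D x₂ = 0) (i j : ℕ) (a : A) :
    hA.coord i j (D a) = ((i : 𝕜) + 1) • σ (hA.coord (i + 1) j a) := by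
  have : hA.coord i j ∘ₗ D = ((i : 𝕜) + 1) • (σ.toLinearMap ∘ₗ hA.coord (i + 1) j) := by
    refine hA.linearMap_ext fun n k l => ?_
    simp only [LinearMap.comp_apply, LinearMap.smul_apply, AlgHom.toLinearMap_apply, ← map_pow]
    rw [coord_monomial, hD, hι, zero_mul, zero_add, hD, skewDerivation_pow_eq_zero hD h₂, mul_zero,
      add_zero, hσ]
    cases k with
    | zero =>
      have h1 : D (x₁ ^ 0) = 0 := by simpa using hι 1
      rw [h1, zero_mul, mul_zero, map_zero, if_neg (by simp), map_zero, smul_zero]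
    | succ k =>
      rw [skewDerivation_pow_succ hD hν h₁, smul_mul_assoc, mul_smul_comm, map_smul, coord_monomial]
      simp only [Nat.add_right_cancel_iff]
      split_ifs with h
      · rw [h.1]
      · rw [map_zero, smul_zero, smul_zero]
  exact LinearMap.congr_fun this a

/-- On coordinates `∂/∂x₂` acts as the usual partial derivative, up to `σ` and to the power of `s` that
arises from moving `∂/∂x₂` past `x₁ⁱ`. -/
theorem coord_skewDerivation₂ (hA : P.IsExtension ι x₁ x₂) {D : A →ₗ[𝕜] A} {ν : A ≃ₐ[𝕜] A}
    (hD : ∀ a b, D (a * b) = D a * b + ν a * D b) {σ : 𝕜[X] →ₐ[𝕜] 𝕜[X]}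
    (hσ : ∀ f, ν (ι f) = ι (σ f)) {s : 𝕜} (hν₁ : ν x₁ = s • x₁) (hν₂ : ν x₂ = x₂)
    (hι : ∀ f, D (ι f) = 0) (h₁ : D x₁ = 0)
    (h₂ : D x₂ = 1) (i j : ℕ) (a : A) :
    hA.coord i j (D a) = (s ^ i * ((j : 𝕜) + 1)) • σ (hA.coord i (j + 1) a) := by
  have : hA.coord i j ∘ₗ D = (s ^ i * ((j : 𝕜) + 1)) • (σ.toLinearMap ∘ₗ hA.coord i (j + 1)) := by
    refine hA.linearMap_ext fun n k l => ?_
    simp only [LinearMap.comp_apply, LinearMap.smul_apply, AlgHom.toLinearMap_apply, ← map_pow]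
    rw [coord_monomial, hD, hι, zero_mul, zero_add, hD, skewDerivation_pow_eq_zero hD h₁, zero_mul,
      zero_add, hσ, map_pow ν, hν₁, _root_.smul_pow]
    cases l with
    | zero =>
      have h1 : D (x₂ ^ 0) = 0 := by simpa using hι 1
      rw [h1, mul_zero, mul_zero, map_zero, if_neg (by simp), map_zero, smul_zero]
    | succ l =>
      rw [skewDerivation_pow_succ hD hν₂ h₂, smul_mul_assoc, mul_smul_comm, mul_smul_comm,
        mul_smul_comm, map_smul, map_smul, coord_monomial, smul_smul]
      simp only [Nat.add_right_cancel_iff]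
      split_ifs with h
      · rw [h.1, h.2]
      · rw [map_zero, smul_zero, smul_zero]
  exact LinearMap.congr_fun this a

theorem isDifferentiallySmooth [CharZero 𝕜] (hA : P.IsExtension ι x₁ x₂) (hP : P.Compatible) :
    IsDifferentiallySmooth 𝕜 A := by
  obtain ⟨S, hD₁ι, hD₂ι, ⟨hD₂x₁, hD₂x₂⟩, hD₃ι, ⟨hD₃x₁, hD₃x₂⟩, ⟨σ₂, hσ₂⟩, hν₂, ⟨σ₃, hσ₃⟩, hν₃₁,
    hν₃₂⟩ := hA.exists_frame hP
  have hιinj : Function.Injective ι := hA.isSkewPBW.injective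
  have : Nontrivial A := hιinj.nontrivial
  have hσinj : ∀ (ν : A ≃ₐ[𝕜] A) (σ : 𝕜[X] →ₐ[𝕜] 𝕜[X]), (∀ f, ν (ι f) = ι (σ f)) →
      ∀ f, σ f = 0 → f = 0 := by
    intro ν σ h f hf
    have := h f
    rw [hf, map_zero, map_eq_zero_iff _ ν.injective, map_eq_zero_iff _ hιinj] at this
    exact this
  refine ⟨hA.finiteType, 3, by rw [hA.gkDim_eq_three]; rfl, S.calculus,
    SkewFrame.calculus_hasDimension, SkewFrame.calculus_isConnected fun a h₁ h₂ h₃ => ?_,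
    SkewFrame.calculus_isIntegrable⟩
  -- the derivatives in `x₁` and `x₂` kill all coordinates but the one at `(0, 0)`
  have ha := hA.eq_of_coord (a := a) (by
    intro i j hij
    cases i with
    | succ i =>
      have := hA.coord_skewDerivation₁ S.leibniz₂ hσ₂ hν₂ hD₂ι hD₂x₁ hD₂x₂ i j a
      rw [h₂, map_zero, eq_comm, smul_eq_zero] at this
      exact hσinj _ _ hσ₂ _ (this.resolve_left (Nat.cast_add_one_ne_zero i))
    | zero =>
      cases j with
      | zero => exact absurd rfl hij
      | succ j =>
        have := hA.coord_skewDerivation₂ S.leibniz₃ hσ₃ hν₃₁ hν₃₂ hD₃ι hD₃x₁ hD₃x₂ 0 j a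
        rw [h₃, map_zero, eq_comm, smul_eq_zero, pow_zero, one_mul] at this
        exact hσinj _ _ hσ₃ _ (this.resolve_left (Nat.cast_add_one_ne_zero j)))
  rw [ha, hD₁ι, map_eq_zero_iff _ hιinj] at h₁
  have hc := derivative_eq_zero.1 h₁
  rw [natDegree_eq_zero] at hc
  obtain ⟨r, hr⟩ := hc
  refine ⟨r, ?_⟩
  rw [ha, ← hr, ← Polynomial.algebraMap_eq, AlgHom.commutes]

/-- Associativity of `x₂ x₁ t` in the untwisted case (equivalently the Jacobi identity) makes the two
vector fields `pᵢ d/dt` commute. -/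
theorem mul_derivative_comm (hA : P.IsExtension ι x₁ x₂) (ha₁ : P.a₁ = 1) (hb₁ : P.b₁ = 0)
    (ha₂ : P.a₂ = 1) (hb₂ : P.b₂ = 0) (hc : P.c = 1) (hq₁ : P.q₁ = 0) (hq₂ : P.q₂ = 0) :
    P.p₂ * derivative P.p₁ = P.p₁ * derivative P.p₂ := by
  apply hA.isSkewPBW.injective
  have h₁ : x₁ * ι X = ι X * x₁ + ι P.p₁ := by
    rw [hA.x₁_mul_X, ha₁, hb₁, one_smul, zero_smul, add_zero]
  have h₂ : x₂ * ι X = ι X * x₂ + ι P.p₂ := by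
    rw [hA.x₂_mul_X, ha₂, hb₂, one_smul, zero_smul, add_zero]
  have h₁₂ : x₂ * x₁ = x₁ * x₂ + algebraMap 𝕜 A P.q₀ := by
    rw [hA.rel₁₂, hc, hq₁, hq₂, one_smul, zero_smul, zero_smul, add_zero, add_zero]
  have e₁ := mul_coeff_of_commutator h₂ P.p₁
  have e₂ := mul_coeff_of_commutator h₁ P.p₂
  have hq : ι X * algebraMap 𝕜 A P.q₀ = algebraMap 𝕜 A P.q₀ * ι X :=
    (Algebra.commutes P.q₀ (ι X)).symm
  -- both sides compute the product of `x₂`, `x₁` and `t`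
  have assoc : x₂ * (x₁ * ι X) = x₂ * x₁ * ι X := (mul_assoc _ _ _).symm
  rw [h₁, h₁₂, mul_add, ← mul_assoc, h₂, add_mul, add_mul, mul_assoc (ι X), h₁₂, e₁, mul_assoc x₁,
    h₂, mul_add x₁, ← mul_assoc x₁, h₁, e₂, add_mul, mul_add, mul_assoc (ι X), hq] at assoc
  change ι _ = ι _
  linear_combination (norm := noncomm_ring) assoc

/-- Associativity of `x₂ x₁ t` when `x₁` acts by an affine substitution and `[x₂, t] = k`. -/
theorem eq_zero_or_c_eq_a₁ (hA : P.IsExtension ι x₁ x₂) (ha₂ : P.a₂ = 1) (hb₂ : P.b₂ = 0)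
    (hp₁ : P.p₁ = 0) {k : 𝕜} (hp₂ : P.p₂ = C k) (hq₀ : P.q₀ = 0) (hq₁ : P.q₁ = 0) (hq₂ : P.q₂ = 0) :
    k = 0 ∨ P.c = P.a₁ := by
  have h₁ : ∀ m, x₁ * (ι X * m) = P.a₁ • (ι X * (x₁ * m)) + P.b₁ • (x₁ * m) := fun m => by
    rw [hA.rel_smul₁, hp₁, map_zero, zero_mul, add_zero]
  have h₂ : ∀ m, x₂ * (ι X * m) = ι X * (x₂ * m) + k • m := fun m => by
    rw [hA.rel_smul₂, ha₂, hb₂, hp₂, ← Polynomial.algebraMap_eq, AlgHom.commutes, one_smul,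
      zero_smul, add_zero, Algebra.smul_def]
  have h₁₂ : ∀ m, x₂ * (x₁ * m) = P.c • (x₁ * (x₂ * m)) := fun m => by
    rw [hA.rel_smul₁₂, hq₀, hq₁, hq₂]
    simp
  -- both sides compute the product of `x₂`, `x₁` and `t`
  have e := h₁₂ (ι X * 1)
  rw [h₁ 1, h₂ 1] at e
  simp only [mul_add, mul_smul_comm] at e
  rw [h₂ (x₁ * 1), h₁ (x₂ * 1), h₁₂ 1] at e
  simp only [mul_one, mul_smul_comm] at e
  have e' : (k * (P.a₁ - P.c)) • x₁ = 0 := by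
    linear_combination (norm := module) e
  have hx : x₁ ≠ 0 := by
    intro h
    exact hA.isSkewPBW.notMem 0 ⟨0, by simp [h]⟩
  rcases mul_eq_zero.1 ((smul_eq_zero.1 e').resolve_right hx) with h | h
  · exact Or.inl h
  · exact Or.inr (sub_eq_zero.1 h).symm

end SkewPBWData.IsExtension

/-! ### The parameter cases -/

namespace SkewPBWData

variable {𝕜 : Type u} {A : Type v} [Field 𝕜] [Ring A] [Algebra 𝕜 A] {P : SkewPBWData 𝕜}
  {ι : 𝕜[X] →ₐ[𝕜] A} {x₁ x₂ : A}

/-- A polynomial of degree one centred at the fixed point of `t ↦ a t + b` is an eigenvector of this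
substitution. -/
theorem comp_shift_center {a b k : 𝕜} (ha : a ≠ 1) :
    (C k * (X + C (b / (a - 1)))).comp (C a * X + C b) = a • (C k * (X + C (b / (a - 1)))) := by
  have h : b + b / (a - 1) = a * (b / (a - 1)) := by
    have : a - 1 ≠ 0 := sub_ne_zero.2 ha
    field_simp
    ring
  have h' := congrArg (C : 𝕜 → 𝕜[X]) h
  rw [C_add, C_mul] at h'
  simp only [mul_comp, add_comp, C_comp, X_comp, smul_eq_C_mul]
  linear_combination C k * h'

theorem smul_shift_center {a b k : 𝕜} (ha : a ≠ 1) :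
    (a - 1) • (C k * (X + C (b / (a - 1)))) =
      (C (a - 1) * X + C b) * derivative (C k * (X + C (b / (a - 1)))) := by
  have h : (a - 1) * (b / (a - 1)) = b := mul_div_cancel₀ b (sub_ne_zero.2 ha)
  have h' := congrArg (C : 𝕜 → 𝕜[X]) h
  rw [C_mul] at h'
  simp only [derivative_C_mul, derivative_add, derivative_X, derivative_C, smul_eq_C_mul]
  linear_combination C k * h'

theorem compatible_of_eq_zero (hb : P.a₁ * P.b₂ + P.b₁ = P.a₂ * P.b₁ + P.b₂) (hp₁ : P.p₁ = 0)
    (hp₂ : P.p₂ = 0) (h : P.QZero) : P.Compatible := by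
  obtain ⟨hq₀, hq₁, hq₂⟩ := h
  exact ⟨hq₁, hq₂, by simp [hq₀], by simp [hq₀], hb, by simp [hp₁], by simp [hp₂],
    by simp [hp₁], by simp [hp₂], by simp [hp₁], by simp [hp₂],
    Or.inl ⟨0, 0, by simp [hp₁], by simp [hp₂]⟩⟩

theorem compatible_of_caseA (hA : P.IsExtension ι x₁ x₂) (h : P.CaseA) : P.Compatible := by
  obtain ⟨⟨ha₁, hb₁, ha₂, hb₂⟩, ⟨hp₁, hp₂, hq⟩ | ⟨hq₁, hq₂, hc⟩⟩ := h
  · exact compatible_of_eq_zero (by rw [hb₁, hb₂]; ring) hp₁ hp₂ hq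
  · have := hA.mul_derivative_comm ha₁ hb₁ ha₂ hb₂ hc hq₁ hq₂
    constructor <;> simp [ha₁, hb₁, ha₂, hb₂, hq₁, hq₂, hc, this]

theorem compatible_of_shiftRows (ha₁ : P.a₁ = 1) (ha₂ : P.a₂ = 1) (h : P.ShiftRows) :
    P.Compatible := by
  have hb : P.a₁ * P.b₂ + P.b₁ = P.a₂ * P.b₁ + P.b₂ := by rw [ha₁, ha₂]; ring
  rcases h with ⟨⟨k₁, hp₁⟩, ⟨k₂, hp₂⟩, hc, hq₁, hq₂⟩ | ⟨hp₁, hp₂, hq⟩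
  · exact ⟨hq₁, hq₂, by simp [hc], by simp [ha₁, ha₂], hb, by simp [hp₁, ha₁],
      by simp [hp₂, ha₁, hc], by simp [hp₁, ha₂, hc], by simp [hp₂, ha₂], by simp [hp₁, ha₁],
      by simp [hp₂, ha₂], Or.inl ⟨0, 0, by simp [hp₁], by simp [hp₂]⟩⟩
  · exact compatible_of_eq_zero hb hp₁ hp₂ hq

theorem compatible_of_caseE (h : P.CaseE) : P.Compatible := by
  obtain ⟨⟨ha₁, hb₁, ha₂⟩, ⟨hq₀, hq₁, hq₂⟩, h⟩ := h
  have hb : P.a₁ * P.b₂ + P.b₁ = P.a₂ * P.b₁ + P.b₂ := by rw [ha₁, hb₁]; ring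
  have hc := P.c_ne
  have ha := P.a₂_ne
  rcases h with ⟨hp₁, ⟨k, hp₂⟩, hc⟩ | ⟨⟨k, hp₁⟩, hp₂, hc⟩ | ⟨hp₁, hp₂, -, -⟩
  · refine ⟨hq₁, hq₂, by simp [hq₀], by simp [hq₀], hb, by simp [hp₁], ?_, by simp [hp₁],
      by rw [hp₂]; exact comp_shift_center ha₂, by simp [hp₁],
      by rw [hp₂]; exact smul_shift_center ha₂, Or.inl ⟨0, k, by simp [hp₁], by simp [hp₂]⟩⟩
    simp [ha₁, hb₁, hc]
  · refine ⟨hq₁, hq₂, by simp [hq₀], by simp [hq₀], hb, by simp [hp₁, ha₁], by simp [hp₂],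
      by simp [hp₁, hc, ha], by simp [hp₂], by simp [hp₁, ha₁], by simp [hp₂],
      Or.inl ⟨0, 0, by simp [hp₁], by simp [hp₂]⟩⟩
  · exact compatible_of_eq_zero hb hp₁ hp₂ ⟨hq₀, hq₁, hq₂⟩

/-- In the row `p₁ = 0`, `p₂ = k` with `c = a₁⁻¹` the compatibility `a₁ p₂ = c p₂` is not part of the
hypotheses: associativity in `A` forces `k = 0` unless `c = a₁`. -/
theorem compatible_of_caseG (hA : P.IsExtension ι x₁ x₂) (h : P.CaseG) : P.Compatible := by
  obtain ⟨⟨ha₁, ha₂, hb₂⟩, ⟨hq₀, hq₁, hq₂⟩, h⟩ := h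
  have hb : P.a₁ * P.b₂ + P.b₁ = P.a₂ * P.b₁ + P.b₂ := by rw [ha₂, hb₂]; ring
  rcases h with ⟨⟨k, hp₁⟩, hp₂, hc⟩ | ⟨hp₁, ⟨k, hp₂⟩, -⟩ | ⟨hp₁, hp₂, -, -⟩
  · refine ⟨hq₁, hq₂, by simp [hq₀], by simp [hq₀], hb, by rw [hp₁]; exact comp_shift_center ha₁,
      by simp [hp₂], ?_, by simp [hp₂], by rw [hp₁]; exact smul_shift_center ha₁, by simp [hp₂],
      Or.inl ⟨k, 0, by simp [hp₁], by simp [hp₂]⟩⟩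
    simp [ha₂, hb₂, hc]
  · rcases hA.eq_zero_or_c_eq_a₁ ha₂ hb₂ hp₁ hp₂ hq₀ hq₁ hq₂ with hk | hc
    · exact compatible_of_eq_zero hb hp₁ (by rw [hp₂, hk, C_0]) ⟨hq₀, hq₁, hq₂⟩
    · exact ⟨hq₁, hq₂, by simp [hq₀], by simp [hq₀], hb, by simp [hp₁],
        by simp [hp₂, hc, P.a₁_ne], by simp [hp₁], by simp [hp₂, ha₂], by simp [hp₁],
        by simp [hp₂, ha₂], Or.inl ⟨0, 0, by simp [hp₁], by simp [hp₂]⟩⟩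
  · exact compatible_of_eq_zero hb hp₁ hp₂ ⟨hq₀, hq₁, hq₂⟩

theorem compatible_of_caseI (h : P.CaseI) : P.Compatible := by
  obtain ⟨⟨-, -, hb₁, hb₂⟩, ⟨k₁, hp₁⟩, ⟨k₂, hp₂⟩, hc, hq₀, hq₁, hq₂⟩ := h
  have h : ∀ a k : 𝕜, (C k * X : 𝕜[X]).comp (C a * X + C 0) = a • (C k * X) := fun a k => by
    rw [mul_comp, C_comp, X_comp, C_0, add_zero, smul_eq_C_mul, mul_left_comm]
  have h' : ∀ a k : 𝕜, (a - 1) • (C k * X : 𝕜[X]) = (C (a - 1) * X + C 0) * derivative (C k * X) :=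
    fun a k => by
      rw [derivative_C_mul, derivative_X, C_0, add_zero, smul_eq_C_mul]
      ring
  exact ⟨hq₁, hq₂, by simp [hq₀], by simp [hq₀], by simp [hb₁, hb₂], by rw [hp₁, hb₁, h],
    by rw [hp₂, hb₁, h, hc, inv_one, one_mul], by rw [hp₁, hb₂, h, hc, one_mul],
    by rw [hp₂, hb₂, h], by rw [hp₁, hb₁, h'], by rw [hp₂, hb₂, h'],
    Or.inl ⟨k₁, k₂, by simp [hp₁], by simp [hp₂]⟩⟩

end SkewPBWData

end

theorem theorem3p4 {𝕜 : Type u} [Field 𝕜] [CharZero 𝕜] {A : Type v} [Ring A] [Algebra 𝕜 A]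
    (P : SkewPBWData 𝕜) (ι : 𝕜[X] →ₐ[𝕜] A) (x₁ x₂ : A) (hA : P.IsExtension ι x₁ x₂)
    (hP : P.CaseA ∨ P.CaseB ∨ P.CaseC ∨ P.CaseD ∨ P.CaseE ∨ P.CaseG ∨ P.CaseI) :
    IsDifferentiallySmooth 𝕜 A := by
  refine hA.isDifferentiallySmooth ?_
  rcases hP with h | ⟨h, h'⟩ | ⟨h, h'⟩ | ⟨h, h'⟩ | h | h | h
  · exact SkewPBWData.compatible_of_caseA hA h
  · exact SkewPBWData.compatible_of_shiftRows h.1 h.2.2.1 h'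
  · exact SkewPBWData.compatible_of_shiftRows h.1 h.2.2.1 h'
  · exact SkewPBWData.compatible_of_shiftRows h.1 h.2.2.1 h'
  · exact SkewPBWData.compatible_of_caseE h
  · exact SkewPBWData.compatible_of_caseG hA h
  · exact SkewPBWData.compatible_of_caseI h
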